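/- Let $\mathbf O$ be the octonions with conjugation $\bar x$ and inner product $(x|y)$, and let $\mathcal J^1$ be the 27-dimensional real Jordan algebra of the matrices $$h^1(\xi_1,\xi_2,\xi_3;x_1,x_2,x_3)=\begin{pmatrix}\xi_1&\sqrt{-1}x_3&\sqrt{-1}\,\overline{x_2}\\ \sqrt{-1}\,\overline{x_3}&\xi_2&x_1\\ \sqrt{-1}x_2&\overline{x_1}&\xi_3\end{pmatrix},\qquad \xi_i\in\mathbb R,\ x_i\in\mathbf O,$$ over the complexified octonions, with the product $X\circ Y=\tfrac12(XY+YX)$. Let $E_i\in\mathcal J^1$ be the element with $\xi_i=1$ and all other coordinates $0$. Let $\mathrm F_{4(-20)}=\{g\in \mathrm{GL}_{\mathbb R}(\mathcal J^1)\mid g(X\circ Y)=gX\circ gY\}$, with Lie algebra $\mathfrak f_{4(-20)}$. For $i=1,2,3$ let $\sigma_i\in \mathrm F_{4(-20)}$ be the element that fixes $\xi_1,\xi_2,\xi_3,x_i$ and changes the sign of $x_j$ for $j\ne i$, let $\tilde\sigma_i(g)=\sigma_ig\sigma_i^{-1}$, and let $d\tilde\sigma_i$ be its differential at the identity. Let $\theta=d\tilde\sigma_1$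 (a Cartan involution), $K=\{g\in \mathrm F_{4(-20)}\mid\tilde\sigma_1(g)=g\}$ and $\mathfrak k=\{X\in\mathfrak f_{4(-20)}\mid\theta X=X\}$. Let $H_0\in\mathfrak f_{4(-20)}$ be the derivation of $\mathcal J^1$ that maps $h^1(\xi_1,\xi_2,\xi_3;x_1,x_2,x_3)$ to $h^1(-2(1|x_3),\,2(1|x_3),\,0;\ \overline{x_2},\ \overline{x_1},\ (\xi_2-\xi_1)1)$, let $\mathfrak a=\mathbb RH_0$, and let $\alpha$ be the linear functional on $\mathfrak a$ with $\alpha(H_0)=1$. For a linear functional $\lambda$ on $\mathfrak a$ let $\mathfrak g_\lambda=\{X\in\mathfrak f_{4(-20)}\mid[H,X]=\lambda(H)X\text{ for all }H\in\mathfrak a\}$, and let $\Sigma=\{\lambda\ne0\mid\mathfrak g_\lambda\ne0\}$ be the set of roots; it is $\{\pm\alpha,\pm2\alpha\}$. Let $M=\{k\in K\mid kH_0k^{-1}=H_0\}$ and $\mathfrak m=\{X\in\mathfrak k\mid[X,H_0]=0\}$. Let $\epsilon:\Sigma\to\{-1,1\}$ be given by $\epsilon(\pm\alpha)=-1$ and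 $\epsilon(\pm2\alpha)=1$. Then $\epsilon$ is a signature of roots, i.e. $\epsilon(-\lambda)=\epsilon(\lambda)$ for $\lambda\in\Sigma$ and $\epsilon(\lambda+\mu)=\epsilon(\lambda)\epsilon(\mu)$ whenever $\lambda,\mu,\lambda+\mu\in\Sigma$. There is exactly one linear map $\theta_\epsilon:\mathfrak f_{4(-20)}\to\mathfrak f_{4(-20)}$ such that $\theta_\epsilon(X)=\epsilon(\lambda)\theta(X)$ for $\lambda\in\Sigma$, $X\in\mathfrak g_\lambda$, and $\theta_\epsilon(X)=\theta(X)$ for $X\in\mathfrak a\oplus\mathfrak m$. Let $\mathfrak k_\epsilon=\{X\mid\theta_\epsilon X=X\}$, let $(K_\epsilon)^0$ be the connected Lie subgroup of $\mathrm F_{4(-20)}$ with the Lie algebra $\mathfrak k_\epsilon$ (the subgroup generated by $\exp\mathfrak k_\epsilon$), and let $K_\epsilon=(K_\epsilon)^0M$. Then: (1) $\theta_\epsilon=d\tilde\sigma_2$ on $\mathfrak f_{4(-20)}$. (2) $\theta_\epsilon$ lifts to $\mathrm F_{4(-20)}$ as $\tilde\sigma_2$, i.e. $\theta_\epsilon$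 is the differential of $\tilde\sigma_2$ at the identity, and $$K_\epsilon=\{g\in \mathrm F_{4(-20)}\mid\tilde\sigma_2(g)=g\}=\{g\in \mathrm F_{4(-20)}\mid gE_2=E_2\}=\mathrm{Spin}^0(8,1),$$ where $\mathrm{Spin}^0(8,1)$ is, by definition, the notation for the stabilizer of $E_2$ in $\mathrm F_{4(-20)}$. -/

import Mathlib

open Quaternion
open scoped Pointwise

noncomputable section

namespace F420

/-! ## Octonions -/

/-- The Cayley algebra over a commutative ring `R`, as the Cayley–Dickson double of the
quaternions `ℍ[R]`. `Octonion ℝ` are the octonions `𝐎`, and `Octonion ℂ` is their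
complexification (in which `√-1 = Complex.I` is a central scalar). -/
def Octonion (R : Type*) [CommRing R] : Type _ := ℍ[R] × ℍ[R]

namespace Octonion

section Basic

variable {R : Type*} [CommRing R]

instance : AddCommGroup (Octonion R) := inferInstanceAs (AddCommGroup (ℍ[R] × ℍ[R]))

instance : Module R (Octonion R) := inferInstanceAs (Module R (ℍ[R] × ℍ[R]))

instance : Module.Finite R (Octonion R) := inferInstanceAs (Module.Finite R (ℍ[R] × ℍ[R]))

/-- The octonion with the two given quaternion components. -/
def mk (a b : ℍ[R]) : Octonion R := (a, b)

/-- First quaternion component. -/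
def fst (x : Octonion R) : ℍ[R] := Prod.fst x

/-- Second quaternion component. -/
def snd (x : Octonion R) : ℍ[R] := Prod.snd x

@[ext] theorem ext {x y : Octonion R} (h₁ : x.fst = y.fst) (h₂ : x.snd = y.snd) : x = y :=
  Prod.ext h₁ h₂

@[simp] theorem fst_mk (a b : ℍ[R]) : (mk a b).fst = a := rfl
@[simp] theorem snd_mk (a b : ℍ[R]) : (mk a b).snd = b := rfl
@[simp] theorem fst_zero : (0 : Octonion R).fst = 0 := rfl
@[simp] theorem snd_zero : (0 : Octonion R).snd = 0 := rfl
@[simp] theorem fst_add (x y : Octonion R) : (x + y).fst = x.fst + y.fst := rfl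
@[simp] theorem snd_add (x y : Octonion R) : (x + y).snd = x.snd + y.snd := rfl
@[simp] theorem fst_neg (x : Octonion R) : (-x).fst = -x.fst := rfl
@[simp] theorem snd_neg (x : Octonion R) : (-x).snd = -x.snd := rfl
@[simp] theorem fst_sub (x y : Octonion R) : (x - y).fst = x.fst - y.fst := rfl
@[simp] theorem snd_sub (x y : Octonion R) : (x - y).snd = x.snd - y.snd := rfl
@[simp] theorem fst_smul (r : R) (x : Octonion R) : (r • x).fst = r • x.fst := rfl
@[simp] theorem snd_smul (r : R) (x : Octonion R) : (r • x).snd = r • x.snd := rfl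

/-- Cayley–Dickson product `(a, b)(c, d) = (ac - d̄b, da + bc̄)`. -/
instance : Mul (Octonion R) where
  mul x y := mk (x.fst * y.fst - star y.snd * x.snd) (y.snd * x.fst + x.snd * star y.fst)

instance : One (Octonion R) := ⟨mk 1 0⟩

@[simp] theorem fst_mul (x y : Octonion R) :
    (x * y).fst = x.fst * y.fst - star y.snd * x.snd := rfl
@[simp] theorem snd_mul (x y : Octonion R) :
    (x * y).snd = y.snd * x.fst + x.snd * star y.fst := rfl
@[simp] theorem fst_one : (1 : Octonion R).fst = 1 := rfl
@[simp] theorem snd_one : (1 : Octonion R).snd = 0 := rfl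

instance : NonUnitalNonAssocRing (Octonion R) where
  left_distrib x y z := by
    ext1 <;> simp [mul_add, add_mul] <;> abel
  right_distrib x y z := by
    ext1 <;> simp [mul_add, add_mul] <;> abel
  zero_mul x := by ext1 <;> simp
  mul_zero x := by ext1 <;> simp

instance : IsScalarTower R (Octonion R) (Octonion R) where
  smul_assoc r x y := by ext1 <;> simp [smul_sub, smul_add]

instance : SMulCommClass R (Octonion R) (Octonion R) where
  smul_comm r x y := by ext1 <;> simp [smul_sub, smul_add]

/-- Octonion conjugation `(a, b) ↦ (ā, -b)`. -/
def conj : Octonion R →ₗ[R] Octonion R where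
  toFun x := mk (star x.fst) (-x.snd)
  map_add' x y := by ext1 <;> simp [add_comm]
  map_smul' r x := by ext1 <;> simp

@[simp] theorem fst_conj (x : Octonion R) : (conj x).fst = star x.fst := rfl
@[simp] theorem snd_conj (x : Octonion R) : (conj x).snd = -x.snd := rfl

/-- The inner product `(x|y)`, the real part of `x ȳ`. -/
def dot (x y : Octonion R) : R := (x * conj y).fst.re

theorem dot_eq (x y : Octonion R) : dot x y =
    x.fst.re * y.fst.re + x.fst.imI * y.fst.imI + x.fst.imJ * y.fst.imJ + x.fst.imK * y.fst.imK +
    (x.snd.re * y.snd.re + x.snd.imI * y.snd.imI + x.snd.imJ * y.snd.imJ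
      + x.snd.imK * y.snd.imK) := by
  simp [dot]
  ring

theorem dot_add_left (x x' y : Octonion R) : dot (x + x') y = dot x y + dot x' y := by
  simp [dot_eq]
  ring

theorem dot_add_right (x y y' : Octonion R) : dot x (y + y') = dot x y + dot x y' := by
  simp [dot_eq]
  ring

theorem dot_smul_left (r : R) (x y : Octonion R) : dot (r • x) y = r * dot x y := by
  simp [dot_eq]
  ring

theorem dot_smul_right (r : R) (x y : Octonion R) : dot x (r • y) = r * dot x y := by
  simp [dot_eq]
  ring

theorem dot_neg_left (x y : Octonion R) : dot (-x) y = -dot x y := by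
  simp [dot_eq]
  ring

theorem dot_neg_right (x y : Octonion R) : dot x (-y) = -dot x y := by
  simp [dot_eq]
  ring

end Basic

instance : NormedAddCommGroup (Octonion ℝ) := inferInstanceAs (NormedAddCommGroup (ℍ[ℝ] × ℍ[ℝ]))

instance : NormedSpace ℝ (Octonion ℝ) := inferInstanceAs (NormedSpace ℝ (ℍ[ℝ] × ℍ[ℝ]))

/-- The inclusion of the real quaternions in the complexified quaternions. -/
def quatToComplex (q : ℍ[ℝ]) : ℍ[ℂ] := ⟨q.re, q.imI, q.imJ, q.imK⟩

@[simp] theorem re_quatToComplex (q : ℍ[ℝ]) : (quatToComplex q).re = (q.re : ℂ) := rfl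
@[simp] theorem imI_quatToComplex (q : ℍ[ℝ]) : (quatToComplex q).imI = (q.imI : ℂ) := rfl
@[simp] theorem imJ_quatToComplex (q : ℍ[ℝ]) : (quatToComplex q).imJ = (q.imJ : ℂ) := rfl
@[simp] theorem imK_quatToComplex (q : ℍ[ℝ]) : (quatToComplex q).imK = (q.imK : ℂ) := rfl

/-- The inclusion of the octonions in the complexified octonions. -/
def toComplex (x : Octonion ℝ) : Octonion ℂ := mk (quatToComplex x.fst) (quatToComplex x.snd)

@[simp] theorem fst_toComplex (x : Octonion ℝ) : (toComplex x).fst = quatToComplex x.fst := rfl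
@[simp] theorem snd_toComplex (x : Octonion ℝ) : (toComplex x).snd = quatToComplex x.snd := rfl

end Octonion

open Octonion

/-! ## The exceptional Jordan algebra `𝒥¹` -/

/-- `𝒥¹` in the coordinates `(ξ₁, ξ₂, ξ₃; x₁, x₂, x₃)` of `h¹(ξ₁, ξ₂, ξ₃; x₁, x₂, x₃)`.
The indices `1, 2, 3` are represented by `0, 1, 2 : Fin 3`. Only the vector space structure
and the topology of this product type are used. -/
abbrev J1 : Type := (Fin 3 → ℝ) × (Fin 3 → Octonion ℝ)

/-- The Hermitian-type matrix `h¹(ξ₁, ξ₂, ξ₃; x₁, x₂, x₃)` over the complexified octonions. -/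
def h1 (X : J1) : Matrix (Fin 3) (Fin 3) (Octonion ℂ) :=
  !![(X.1 0 : ℂ) • 1, Complex.I • toComplex (X.2 2), Complex.I • toComplex (conj (X.2 1));
     Complex.I • toComplex (conj (X.2 2)), (X.1 1 : ℂ) • 1, toComplex (X.2 0);
     Complex.I • toComplex (X.2 1), toComplex (conj (X.2 0)), (X.1 2 : ℂ) • 1]

theorem h1_injective : Function.Injective h1 := by
  intro X Y h
  have hq : ∀ a b : ℍ[ℝ], quatToComplex a = quatToComplex b → a = b := by
    intro a b hab
    have e1 := congrArg (fun q : ℍ[ℂ] => q.re) hab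
    have e2 := congrArg (fun q : ℍ[ℂ] => q.imI) hab
    have e3 := congrArg (fun q : ℍ[ℂ] => q.imJ) hab
    have e4 := congrArg (fun q : ℍ[ℂ] => q.imK) hab
    simp only [re_quatToComplex, imI_quatToComplex, imJ_quatToComplex, imK_quatToComplex,
      Complex.ofReal_inj] at e1 e2 e3 e4
    exact Quaternion.ext _ _ e1 e2 e3 e4
  have key : ∀ a b : Octonion ℝ, toComplex a = toComplex b → a = b := fun a b hab =>
    Octonion.ext (hq _ _ (congrArg Octonion.fst hab)) (hq _ _ (congrArg Octonion.snd hab))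
  have hr : ∀ r s : ℝ, (r : ℂ) • (1 : Octonion ℂ) = (s : ℂ) • 1 → r = s := by
    intro r s hrs
    have := congrArg (fun z : Octonion ℂ => z.fst.re) hrs
    simp only [fst_smul, fst_one, Quaternion.re_smul, Quaternion.re_one, smul_eq_mul, mul_one,
      Complex.ofReal_inj] at this
    exact this
  have hI : ∀ a b : Octonion ℝ, Complex.I • toComplex a = Complex.I • toComplex b → a = b := by
    intro a b hab
    have := congrArg (fun z => (-Complex.I) • z) hab
    simp only [smul_smul, neg_mul, Complex.I_mul_I, neg_neg, one_smul] at this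
    exact key a b this
  have e := fun i j => congrFun (congrFun h i) j
  apply Prod.ext
  · funext i
    fin_cases i
    · exact hr _ _ (e 0 0)
    · exact hr _ _ (e 1 1)
    · exact hr _ _ (e 2 2)
  · funext i
    fin_cases i
    · exact key _ _ (e 1 2)
    · exact hI _ _ (e 2 0)
    · exact hI _ _ (e 0 1)

/-- The Jordan product in coordinates. By `h1_jordanFun` it is `X ∘ Y = 2⁻¹ (XY + YX)`. -/
def jordanFun (X Y : J1) : J1 :=
  (![X.1 0 * Y.1 0 - dot (X.2 1) (Y.2 1) - dot (X.2 2) (Y.2 2),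
     X.1 1 * Y.1 1 + dot (X.2 0) (Y.2 0) - dot (X.2 2) (Y.2 2),
     X.1 2 * Y.1 2 + dot (X.2 0) (Y.2 0) - dot (X.2 1) (Y.2 1)],
   ![(2⁻¹ : ℝ) • ((X.1 1 + X.1 2) • Y.2 0 + (Y.1 1 + Y.1 2) • X.2 0
        - (conj (X.2 1 * Y.2 2) + conj (Y.2 1 * X.2 2))),
     (2⁻¹ : ℝ) • ((X.1 2 + X.1 0) • Y.2 1 + (Y.1 2 + Y.1 0) • X.2 1
        + (conj (X.2 2 * Y.2 0) + conj (Y.2 2 * X.2 0))),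
     (2⁻¹ : ℝ) • ((X.1 0 + X.1 1) • Y.2 2 + (Y.1 0 + Y.1 1) • X.2 2
        + (conj (X.2 0 * Y.2 1) + conj (Y.2 0 * X.2 1)))])

theorem J1_ext {X Y : J1} (h0 : X.1 0 = Y.1 0) (h1 : X.1 1 = Y.1 1) (h2 : X.1 2 = Y.1 2)
    (k0 : X.2 0 = Y.2 0) (k1 : X.2 1 = Y.2 1) (k2 : X.2 2 = Y.2 2) : X = Y := by
  refine Prod.ext (funext fun i => ?_) (funext fun i => ?_)
  · fin_cases i
    exacts [h0, h1, h2]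
  · fin_cases i
    exacts [k0, k1, k2]

section

variable (X Y : J1)

theorem jordanFun_fst_zero : (jordanFun X Y).1 0 =
    X.1 0 * Y.1 0 - dot (X.2 1) (Y.2 1) - dot (X.2 2) (Y.2 2) := rfl

theorem jordanFun_fst_one : (jordanFun X Y).1 1 =
    X.1 1 * Y.1 1 + dot (X.2 0) (Y.2 0) - dot (X.2 2) (Y.2 2) := rfl

theorem jordanFun_fst_two : (jordanFun X Y).1 2 =
    X.1 2 * Y.1 2 + dot (X.2 0) (Y.2 0) - dot (X.2 1) (Y.2 1) := rfl

theorem jordanFun_snd_zero : (jordanFun X Y).2 0 =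
    (2⁻¹ : ℝ) • ((X.1 1 + X.1 2) • Y.2 0 + (Y.1 1 + Y.1 2) • X.2 0
        - (conj (X.2 1 * Y.2 2) + conj (Y.2 1 * X.2 2))) := rfl

theorem jordanFun_snd_one : (jordanFun X Y).2 1 =
    (2⁻¹ : ℝ) • ((X.1 2 + X.1 0) • Y.2 1 + (Y.1 2 + Y.1 0) • X.2 1
        + (conj (X.2 2 * Y.2 0) + conj (Y.2 2 * X.2 0))) := rfl

theorem jordanFun_snd_two : (jordanFun X Y).2 2 =
    (2⁻¹ : ℝ) • ((X.1 0 + X.1 1) • Y.2 2 + (Y.1 0 + Y.1 1) • X.2 2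
        + (conj (X.2 0 * Y.2 1) + conj (Y.2 0 * X.2 1))) := rfl

end

theorem toComplex_add (x y : Octonion ℝ) : toComplex (x + y) = toComplex x + toComplex y := by
  apply Octonion.ext <;> apply Quaternion.ext <;> simp

theorem toComplex_sub (x y : Octonion ℝ) : toComplex (x - y) = toComplex x - toComplex y := by
  apply Octonion.ext <;> apply Quaternion.ext <;> simp

theorem toComplex_smul (r : ℝ) (x : Octonion ℝ) :
    toComplex (r • x) = (r : ℂ) • toComplex x := by
  apply Octonion.ext <;> apply Quaternion.ext <;> simp [-Complex.coe_smul]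

theorem toComplex_mul (x y : Octonion ℝ) : toComplex (x * y) = toComplex x * toComplex y := by
  apply Octonion.ext <;> apply Quaternion.ext <;> simp

theorem toComplex_conj (x : Octonion ℝ) : toComplex (conj x) = conj (toComplex x) := by
  apply Octonion.ext <;> apply Quaternion.ext <;> simp

theorem ofReal_dot (x y : Octonion ℝ) :
    ((dot x y : ℝ) : ℂ) = dot (toComplex x) (toComplex y) := by
  simp [dot_eq]

/-- `𝒥¹` is closed under the Jordan product of matrices, which is given by `jordanFun`. -/
theorem h1_jordanFun (X Y : J1) :
    h1 (jordanFun X Y) = (2⁻¹ : ℂ) • (h1 X * h1 Y + h1 Y * h1 X) := by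
  have e1 : ∀ x y : Octonion ℂ, x * conj y + y * conj x = (2 * dot x y) • 1 := by
    intro x y
    rw [dot_eq]
    apply Octonion.ext <;> apply Quaternion.ext <;> simp <;> ring
  have e2 : ∀ x y : Octonion ℂ, conj x * y + conj y * x = (2 * dot x y) • 1 := by
    intro x y
    rw [dot_eq]
    apply Octonion.ext <;> apply Quaternion.ext <;> simp <;> ring
  have one_mul' : ∀ x : Octonion ℂ, 1 * x = x := fun x => by
    apply Octonion.ext <;> simp
  have mul_one' : ∀ x : Octonion ℂ, x * 1 = x := fun x => by
    apply Octonion.ext <;> simp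
  have conj_mul : ∀ x y : Octonion ℂ, conj (x * y) = conj y * conj x := fun x y => by
    apply Octonion.ext <;> simp
  have conj_conj : ∀ x : Octonion ℂ, conj (conj x) = x := fun x => by
    apply Octonion.ext <;> simp
  have hI : Complex.I * Complex.I = -1 := Complex.I_mul_I
  have f1 := fun i => e1 (toComplex (X.2 i)) (toComplex (Y.2 i))
  have f2 := fun i => e2 (toComplex (X.2 i)) (toComplex (Y.2 i))
  ext1 i j
  rw [Matrix.smul_apply, Matrix.add_apply, Matrix.mul_apply, Matrix.mul_apply,
    Fin.sum_univ_three, Fin.sum_univ_three]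
  fin_cases i <;> fin_cases j
  all_goals simp only [h1, jordanFun_fst_zero, jordanFun_fst_one, jordanFun_fst_two, jordanFun_snd_zero,
    jordanFun_snd_one, jordanFun_snd_two, toComplex_add, toComplex_sub, toComplex_smul,
    toComplex_mul, toComplex_conj, ofReal_dot, Complex.ofReal_add, Complex.ofReal_sub,
    Complex.ofReal_mul, Matrix.of_apply, Matrix.cons_val', Matrix.cons_val_zero,
    Matrix.cons_val_one, Matrix.cons_val_fin_one, Fin.zero_eta, Fin.mk_one, Fin.reduceFinMk,
    Matrix.cons_val, smul_mul_assoc, mul_smul_comm, one_mul', mul_one', smul_smul, hI, map_add,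
    map_sub, map_smul, conj_mul, conj_conj, Complex.ofReal_inv, Complex.ofReal_ofNat]
  · linear_combination (norm := module) (2⁻¹ : ℂ) • f1 2 + (2⁻¹ : ℂ) • f2 1
  · module
  · module
  · module
  · linear_combination (norm := module) (2⁻¹ : ℂ) • f2 2 - (2⁻¹ : ℂ) • f1 0
  · module
  · module
  · module
  · linear_combination (norm := module) (2⁻¹ : ℂ) • f1 1 - (2⁻¹ : ℂ) • f2 0

/-- The Jordan product `X ∘ Y` as a bilinear map. -/
def jordan : J1 →ₗ[ℝ] J1 →ₗ[ℝ] J1 :=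
  LinearMap.mk₂ ℝ jordanFun
    (fun X X' Y => by
      apply J1_ext
      all_goals simp only [jordanFun_fst_zero, jordanFun_fst_one, jordanFun_fst_two, jordanFun_snd_zero,
          jordanFun_snd_one, jordanFun_snd_two, Prod.fst_add, Prod.snd_add, Pi.add_apply, dot_add_left, add_mul, mul_add, map_add]
      iterate 3 ring
      all_goals module)
    (fun c X Y => by
      apply J1_ext
      all_goals simp only [jordanFun_fst_zero, jordanFun_fst_one, jordanFun_fst_two, jordanFun_snd_zero,
          jordanFun_snd_one, jordanFun_snd_two, Prod.smul_fst, Prod.smul_snd, Pi.smul_apply,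
          dot_smul_left, smul_mul_assoc, mul_smul_comm, map_smul, smul_eq_mul]
      iterate 3 ring
      all_goals module)
    (fun X Y Y' => by
      apply J1_ext
      all_goals simp only [jordanFun_fst_zero, jordanFun_fst_one, jordanFun_fst_two, jordanFun_snd_zero,
          jordanFun_snd_one, jordanFun_snd_two, Prod.fst_add, Prod.snd_add, Pi.add_apply, dot_add_right, add_mul, mul_add, map_add]
      iterate 3 ring
      all_goals module)
    (fun c X Y => by
      apply J1_ext
      all_goals simp only [jordanFun_fst_zero, jordanFun_fst_one, jordanFun_fst_two, jordanFun_snd_zero,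
          jordanFun_snd_one, jordanFun_snd_two, Prod.smul_fst, Prod.smul_snd, Pi.smul_apply,
          dot_smul_right, smul_mul_assoc, mul_smul_comm, map_smul, smul_eq_mul]
      iterate 3 ring
      all_goals module)

theorem jordan_apply (X Y : J1) : jordan X Y = jordanFun X Y := rfl

/-- The element `E_i`. -/
def E (i : Fin 3) : J1 := (Pi.single i 1, 0)

/-! ## The group `F_{4(-20)}` and its Lie algebra -/

/-- `F_{4(-20)}`: the linear automorphisms of `𝒥¹` that preserve the Jordan product. (As `𝒥¹`
is finite-dimensional, every linear automorphism is continuous.) -/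
def F4 : Subgroup (J1 ≃L[ℝ] J1) where
  carrier := {g | ∀ X Y : J1, g (jordan X Y) = jordan (g X) (g Y)}
  mul_mem' {a b} ha hb X Y := by
    change a (b _) = _
    rw [hb, ha]; rfl
  one_mem' X Y := rfl
  inv_mem' {a} ha X Y := by
    change a.symm _ = jordan (a.symm X) (a.symm Y)
    rw [ContinuousLinearEquiv.symm_apply_eq, ha]
    simp

theorem mem_F4 {g : J1 ≃L[ℝ] J1} :
    g ∈ F4 ↔ ∀ X Y : J1, g (jordan X Y) = jordan (g X) (g Y) := Iff.rfl

/-- The normed `ℚ`-algebra structure that the lemmas on the exponential series ask for. -/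
local instance normedAlgebraRat : NormedAlgebra ℚ (J1 →L[ℝ] J1) :=
  NormedAlgebra.restrictScalars ℚ ℝ _

/-- The exponential of an endomorphism of `𝒥¹`, as an element of `GL(𝒥¹)`. -/
def expGL (D : J1 →L[ℝ] J1) : J1 ≃L[ℝ] J1 :=
  ContinuousLinearEquiv.equivOfInverse (NormedSpace.exp D) (NormedSpace.exp (-D))
    (fun X => by
      have h : NormedSpace.exp (-D) * NormedSpace.exp D = 1 := by
        rw [← NormedSpace.exp_add_of_commute (Commute.refl D).neg_left, neg_add_cancel,
          NormedSpace.exp_zero]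
      exact congrArg (fun T : J1 →L[ℝ] J1 => T X) h)
    (fun X => by
      have h : NormedSpace.exp D * NormedSpace.exp (-D) = 1 := by
        rw [← NormedSpace.exp_add_of_commute (Commute.refl D).neg_right, add_neg_cancel,
          NormedSpace.exp_zero]
      exact congrArg (fun T : J1 →L[ℝ] J1 => T X) h)

@[simp] theorem coe_expGL (D : J1 →L[ℝ] J1) :
    (expGL D : J1 →L[ℝ] J1) = NormedSpace.exp D := rfl

theorem expGL_apply (D : J1 →L[ℝ] J1) (X : J1) : expGL D X = NormedSpace.exp D X := rfl

/-- `D` is a derivation of the Jordan algebra `𝒥¹`. -/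
def IsDerivation (D : J1 →L[ℝ] J1) : Prop :=
  ∀ X Y : J1, D (jordan X Y) = jordan (D X) Y + jordan X (D Y)

theorem forall_expGL_mem_iff (D : J1 →L[ℝ] J1) :
    (∀ t : ℝ, expGL (t • D) ∈ F4) ↔ IsDerivation D := by
  set B : J1 →L[ℝ] J1 →L[ℝ] J1 := jordan.toContinuousBilinearMap with hB
  have hBJ : ∀ X Y, jordan X Y = B X Y := fun X Y => rfl
  have hexp : ∀ (X : J1) (t : ℝ), HasDerivAt (fun s : ℝ => NormedSpace.exp (s • D) X)
      (D (NormedSpace.exp (t • D) X)) t := fun X t =>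
    (hasDerivAt_exp_smul_const' (𝕂 := ℝ) D t).clm_apply (hasDerivAt_const t X) |>.congr_deriv
      (by simp)
  have hprod : ∀ (X Y : J1) (t : ℝ),
      HasDerivAt (fun s : ℝ => B (NormedSpace.exp (s • D) X) (NormedSpace.exp (s • D) Y))
      (B (D (NormedSpace.exp (t • D) X)) (NormedSpace.exp (t • D) Y)
        + B (NormedSpace.exp (t • D) X) (D (NormedSpace.exp (t • D) Y))) t := fun X Y t =>
    ((B.hasFDerivAt.comp_hasDerivAt t (hexp X t)).clm_apply (hexp Y t))
  constructor
  · intro h X Y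
    have h1 := hexp (jordan X Y) 0
    have h2 := hprod X Y 0
    have h3 : (fun s : ℝ => B (NormedSpace.exp (s • D) X) (NormedSpace.exp (s • D) Y))
        = fun s : ℝ => NormedSpace.exp (s • D) (jordan X Y) := by
      funext s
      exact (h s X Y).symm
    rw [h3] at h2
    have := h1.unique h2
    simpa [hBJ] using this
  · intro h t X Y
    have hneg : ∀ t : ℝ, HasDerivAt (fun s : ℝ => NormedSpace.exp (s • (-D)))
        (NormedSpace.exp (t • (-D)) * (-D)) t := fun t =>
      hasDerivAt_exp_smul_const (𝕂 := ℝ) (-D) t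
    have hd : ∀ t : ℝ, HasDerivAt (fun s : ℝ => NormedSpace.exp (s • (-D))
        (B (NormedSpace.exp (s • D) X) (NormedSpace.exp (s • D) Y))) 0 t := by
      intro t
      refine ((hneg t).clm_apply (hprod X Y t)).congr_deriv ?_
      have := h (NormedSpace.exp (t • D) X) (NormedSpace.exp (t • D) Y)
      rw [hBJ, hBJ, hBJ] at this
      rw [← this]
      simp
    have hconst := is_const_of_deriv_eq_zero (fun t => (hd t).differentiableAt)
      (fun t => (hd t).deriv) t 0
    have hinv : NormedSpace.exp (t • D) * NormedSpace.exp (t • (-D)) = 1 := by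
      rw [smul_neg, ← NormedSpace.exp_add_of_commute (Commute.refl (t • D)).neg_right,
        add_neg_cancel, NormedSpace.exp_zero]
    have h4 := congrArg (fun v : J1 => (NormedSpace.exp (t • D) : J1 →L[ℝ] J1) v) hconst
    simp only [zero_smul, NormedSpace.exp_zero, one_apply_eq_self] at h4
    have h5 := congrArg (fun T : J1 →L[ℝ] J1 =>
      T (B (NormedSpace.exp (t • D) X) (NormedSpace.exp (t • D) Y))) hinv
    exact h4.symm.trans h5

instance : LieRing (J1 →L[ℝ] J1) := LieRing.ofAssociativeRing

instance : LieAlgebra ℝ (J1 →L[ℝ] J1) := LieAlgebra.ofAssociativeAlgebra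

/-- The Lie algebra `𝔣_{4(-20)} = Lie(F_{4(-20)})` of the linear group `F_{4(-20)}`: all
endomorphisms `D` of `𝒥¹` such that `exp(tD)` lies in the group for all real `t`, with the
commutator as bracket. -/
def f4 : LieSubalgebra ℝ (J1 →L[ℝ] J1) where
  carrier := {D | ∀ t : ℝ, expGL (t • D) ∈ F4}
  add_mem' {a b} ha hb := by
    rw [Set.mem_ofPred_eq, forall_expGL_mem_iff] at *
    intro X Y
    simp only [_root_.add_apply, ha X Y, hb X Y, map_add, LinearMap.add_apply]
    abel
  zero_mem' := by
    rw [Set.mem_ofPred_eq, forall_expGL_mem_iff] at *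
    intro X Y
    simp
  smul_mem' c a ha := by
    rw [Set.mem_ofPred_eq, forall_expGL_mem_iff] at *
    intro X Y
    simp only [_root_.smul_apply, ha X Y, map_smul, LinearMap.smul_apply, smul_add]
  lie_mem' {a b} ha hb := by
    change ∀ t : ℝ, expGL (t • a) ∈ F4 at ha
    change ∀ t : ℝ, expGL (t • b) ∈ F4 at hb
    change ∀ t : ℝ, expGL (t • (a * b - b * a)) ∈ F4
    rw [forall_expGL_mem_iff] at *
    intro X Y
    simp only [_root_.sub_apply, mul_apply_eq_comp, ha X Y, hb X Y,
      ha (b X) Y, ha X (b Y), hb (a X) Y, hb X (a Y), map_add, map_sub, LinearMap.sub_apply]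
    abel

instance : LieRing f4 := LieSubalgebra.lieRing ℝ (J1 →L[ℝ] J1) f4

instance : AddCommGroup f4 := LieRing.toAddCommGroup

instance : LieAlgebra ℝ f4 := LieSubalgebra.lieAlgebra ℝ (J1 →L[ℝ] J1) f4

instance : Module ℝ f4 := LieAlgebra.toModule

instance : SMul ℝ f4 := Module.toDistribMulAction.toDistribSMul.toSMulZeroClass.toSMul

theorem mem_f4 {D : J1 →L[ℝ] J1} : D ∈ f4 ↔ ∀ t : ℝ, expGL (t • D) ∈ F4 := Iff.rfl

theorem mem_f4_iff_isDerivation {D : J1 →L[ℝ] J1} : D ∈ f4 ↔ IsDerivation D :=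
  forall_expGL_mem_iff D

/-- The exponential map `𝔣_{4(-20)} → F_{4(-20)}`. -/
def exp (D : f4) : F4 :=
  ⟨expGL (D : J1 →L[ℝ] J1), by simpa using mem_f4.1 D.2 1⟩

/-- The linear map `T` is the differential at the identity of the automorphism `φ` of
`F_{4(-20)}`. -/
def IsDifferential (φ : F4 ≃* F4) (T : f4 →ₗ[ℝ] f4) : Prop :=
  ∀ D : f4, HasDerivAt
    (fun t : ℝ => (((φ (exp (t • D)) : F4) : J1 ≃L[ℝ] J1) : J1 →L[ℝ] J1))
    (T D : J1 →L[ℝ] J1) 0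

/-- Conjugation of an endomorphism by an element of `GL(𝒥¹)`. -/
def conjEnd (g : J1 ≃L[ℝ] J1) (D : J1 →L[ℝ] J1) : J1 →L[ℝ] J1 :=
  (g : J1 →L[ℝ] J1) * D * (g.symm : J1 →L[ℝ] J1)

theorem conjEnd_apply (g : J1 ≃L[ℝ] J1) (D : J1 →L[ℝ] J1) (X : J1) :
    conjEnd g D X = g (D (g.symm X)) := rfl

theorem conjEnd_mem (g : F4) {D : J1 →L[ℝ] J1} (hD : D ∈ f4) :
    conjEnd (g : J1 ≃L[ℝ] J1) D ∈ f4 := by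
  rw [mem_f4_iff_isDerivation] at *
  intro X Y
  have h1 := mem_F4.1 g.2
  have h2 : ∀ X Y, (g : J1 ≃L[ℝ] J1).symm (jordan X Y) =
      jordan ((g : J1 ≃L[ℝ] J1).symm X) ((g : J1 ≃L[ℝ] J1).symm Y) :=
    mem_F4.1 (F4.inv_mem g.2)
  simp only [conjEnd_apply, h2, hD _ _, map_add, h1, ContinuousLinearEquiv.apply_symm_apply]

/-- The adjoint action `D ↦ g D g⁻¹` of the group on its Lie algebra. -/
def Ad (g : F4) : f4 ≃ₗ⁅ℝ⁆ f4 where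
  toFun D := ⟨conjEnd g D, conjEnd_mem g D.2⟩
  invFun D := ⟨conjEnd (g⁻¹ : F4) D, conjEnd_mem g⁻¹ D.2⟩
  map_add' D D' := by
    refine Subtype.ext (ContinuousLinearMap.ext fun X => ?_)
    change (g : J1 ≃L[ℝ] J1) _ = _
    simp [conjEnd_apply]
  map_smul' c D := by
    refine Subtype.ext (ContinuousLinearMap.ext fun X => ?_)
    simp [conjEnd_apply]
  map_lie' {D D'} := by
    ext1
    refine ContinuousLinearMap.ext fun X => ?_
    change (g : J1 ≃L[ℝ] J1) ((D : J1 →L[ℝ] J1) ((D' : J1 →L[ℝ] J1) _) -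
      (D' : J1 →L[ℝ] J1) ((D : J1 →L[ℝ] J1) _)) = conjEnd g D (conjEnd g D' X) -
      conjEnd g D' (conjEnd g D X)
    simp [conjEnd_apply]
  left_inv D := by
    refine Subtype.ext (ContinuousLinearMap.ext fun X => ?_)
    change (g : J1 ≃L[ℝ] J1).symm ((g : J1 ≃L[ℝ] J1) ((D : J1 →L[ℝ] J1)
      ((g : J1 ≃L[ℝ] J1).symm ((g : J1 ≃L[ℝ] J1) X)))) = _
    simp
  right_inv D := by
    refine Subtype.ext (ContinuousLinearMap.ext fun X => ?_)
    change (g : J1 ≃L[ℝ] J1) ((g : J1 ≃L[ℝ] J1).symm ((D : J1 →L[ℝ] J1)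
      ((g : J1 ≃L[ℝ] J1) ((g : J1 ≃L[ℝ] J1).symm X)))) = _
    simp

theorem coe_Ad (g : F4) (D : f4) : (Ad g D : J1 →L[ℝ] J1) = conjEnd g D := rfl

/-- `Ad g` is the differential of the inner automorphism defined by `g`. -/
theorem isDifferential_Ad (g : F4) : IsDifferential (MulAut.conj g) (Ad g : f4 →ₗ[ℝ] f4) := by
  intro D
  have h1 := hasDerivAt_exp_smul_const (𝕂 := ℝ) (D : J1 →L[ℝ] J1) 0
  simp only [zero_smul, NormedSpace.exp_zero, one_mul] at h1
  exact (h1.const_mul ((g : J1 ≃L[ℝ] J1) : J1 →L[ℝ] J1)).mul_const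
    ((g : J1 ≃L[ℝ] J1).symm : J1 →L[ℝ] J1)

/-! ## The involutions `σ_i` -/

/-- The linear map `σ_i`, which changes the signs of the octonions `x_j` with `j ≠ i`. -/
def sigmaLin (i : Fin 3) : J1 →ₗ[ℝ] J1 where
  toFun X := (X.1, fun j => if j = i then X.2 j else -X.2 j)
  map_add' X Y := by
    refine Prod.ext rfl (funext fun j => ?_)
    by_cases h : j = i <;> simp [h, add_comm]
  map_smul' c X := by
    refine Prod.ext rfl (funext fun j => ?_)
    by_cases h : j = i <;> simp [h]

theorem sigmaLin_involutive (i : Fin 3) : Function.Involutive (sigmaLin i) := by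
  intro X
  refine Prod.ext rfl (funext fun j => ?_)
  by_cases h : j = i <;> simp [sigmaLin, h]

/-- The element `σ_i` of `F_{4(-20)}`. -/
def sigma (i : Fin 3) : F4 :=
  ⟨(LinearEquiv.ofInvolutive (sigmaLin i) (sigmaLin_involutive i)).toContinuousLinearEquiv, by
    intro X Y
    change sigmaLin i (jordanFun X Y) = jordanFun (sigmaLin i X) (sigmaLin i Y)
    have h0 : ∀ Z : J1, (sigmaLin i Z).1 = Z.1 := fun _ => rfl
    have h1 : ∀ (Z : J1) (j : Fin 3), (sigmaLin i Z).2 j = if j = i then Z.2 j else -Z.2 j :=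
      fun _ _ => rfl
    apply J1_ext
    all_goals simp only [jordanFun_fst_zero, jordanFun_fst_one, jordanFun_fst_two,
      jordanFun_snd_zero, jordanFun_snd_one, jordanFun_snd_two, h0, h1]
    all_goals fin_cases i <;> simp [dot_neg_left, dot_neg_right] <;> module⟩

theorem sigma_apply (i : Fin 3) (X : J1) :
    (sigma i : J1 ≃L[ℝ] J1) X = (X.1, fun j => if j = i then X.2 j else -X.2 j) := rfl

/-- The involutive inner automorphism `σ̃_i : g ↦ σ_i g σ_i⁻¹`. -/
def sigmaTilde (i : Fin 3) : F4 ≃* F4 := MulAut.conj (sigma i)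

/-- The differential `dσ̃_i : D ↦ σ_i D σ_i⁻¹` of `σ̃_i`. -/
def dsigma (i : Fin 3) : f4 ≃ₗ⁅ℝ⁆ f4 := Ad (sigma i)

theorem isDifferential_dsigma (i : Fin 3) :
    IsDifferential (sigmaTilde i) (dsigma i : f4 →ₗ[ℝ] f4) := isDifferential_Ad (sigma i)

/-- The subgroup of the fixed elements of an automorphism of `F_{4(-20)}`. -/
def fixedSubgroup (φ : F4 ≃* F4) : Subgroup F4 where
  carrier := {g | φ g = g}
  mul_mem' {a b} ha hb := by
    change φ (a * b) = a * b
    rw [map_mul, show φ a = a from ha, show φ b = b from hb]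
  one_mem' := map_one φ
  inv_mem' {a} ha := by
    change φ a⁻¹ = a⁻¹
    rw [map_inv, show φ a = a from ha]

/-- The stabilizer of an element of `𝒥¹` in `F_{4(-20)}`. -/
def stab (X : J1) : Subgroup F4 where
  carrier := {g | (g : J1 ≃L[ℝ] J1) X = X}
  mul_mem' {a b} ha hb := by
    change (a : J1 ≃L[ℝ] J1) ((b : J1 ≃L[ℝ] J1) X) = X
    rw [show (b : J1 ≃L[ℝ] J1) X = X from hb, show (a : J1 ≃L[ℝ] J1) X = X from ha]
  one_mem' := rfl
  inv_mem' {a} ha := by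
    change (a : J1 ≃L[ℝ] J1).symm X = X
    rw [ContinuousLinearEquiv.symm_apply_eq]
    exact (show (a : J1 ≃L[ℝ] J1) X = X from ha).symm

/-- `Spin⁰(8,1)` is by definition the stabilizer of `E₂`. -/
def Spin81 : Subgroup F4 := stab (E 1)

/-! ## The Cartan involution, `𝔞`, and the restricted roots -/

/-- The Cartan involution `θ = dσ̃`, where `σ = σ₁`. -/
def theta : f4 ≃ₗ⁅ℝ⁆ f4 := dsigma 0

/-- The maximal compact subgroup `K`, the fixed group of `σ̃`. -/
def K : Subgroup F4 := fixedSubgroup (sigmaTilde 0)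

/-- The Lie algebra `𝔨` of the fixed points of `θ`. -/
def k : Submodule ℝ f4 := LinearMap.eqLocus (theta : f4 →ₗ[ℝ] f4) LinearMap.id

/-- The endomorphism `Ã₃¹(1)` of `𝒥¹`, the generator of the one-parameter group `a_t`:
`ξ₁' = -2(1|x₃)`, `ξ₂' = 2(1|x₃)`, `ξ₃' = 0`, `x₁'` is the conjugate of `x₂`, `x₂'` is the
conjugate of `x₁`, and `x₃' = -(ξ₁ - ξ₂)1`. -/
def A3Fun (X : J1) : J1 :=
  (![-2 * dot 1 (X.2 2), 2 * dot 1 (X.2 2), 0],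
   ![conj (X.2 1), conj (X.2 0), -(X.1 0 - X.1 1) • 1])

section

variable (X : J1)

theorem A3Fun_fst_zero : (A3Fun X).1 0 = -2 * dot 1 (X.2 2) := rfl
theorem A3Fun_fst_one : (A3Fun X).1 1 = 2 * dot 1 (X.2 2) := rfl
theorem A3Fun_fst_two : (A3Fun X).1 2 = 0 := rfl
theorem A3Fun_snd_zero : (A3Fun X).2 0 = conj (X.2 1) := rfl
theorem A3Fun_snd_one : (A3Fun X).2 1 = conj (X.2 0) := rfl
theorem A3Fun_snd_two : (A3Fun X).2 2 = -(X.1 0 - X.1 1) • 1 := rfl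

end

/-- `Ã₃¹(1)` as a linear map. -/
def A3Lin : J1 →ₗ[ℝ] J1 where
  toFun := A3Fun
  map_add' X Y := by
    apply J1_ext
    all_goals simp only [A3Fun_fst_zero, A3Fun_fst_one, A3Fun_fst_two, A3Fun_snd_zero,
      A3Fun_snd_one, A3Fun_snd_two, Prod.fst_add, Prod.snd_add, Pi.add_apply, dot_add_right,
      map_add]
    all_goals first | ring1 | module
  map_smul' c X := by
    apply J1_ext
    all_goals simp only [A3Fun_fst_zero, A3Fun_fst_one, A3Fun_fst_two, A3Fun_snd_zero,
      A3Fun_snd_one, A3Fun_snd_two, Prod.smul_fst, Prod.smul_snd, Pi.smul_apply, dot_smul_right,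
      map_smul, smul_eq_mul, RingHom.id_apply]
    all_goals first | ring1 | module

set_option linter.unusedSimpArgs false in
theorem isDerivation_A3 : IsDerivation (LinearMap.toContinuousLinearMap A3Lin) := by
  intro X Y
  have one_mul' : ∀ x : Octonion ℝ, 1 * x = x := fun x => by
    apply Octonion.ext <;> simp
  have mul_one' : ∀ x : Octonion ℝ, x * 1 = x := fun x => by
    apply Octonion.ext <;> simp
  have conj_mul : ∀ x y : Octonion ℝ, conj (x * y) = conj y * conj x := fun x y => by
    apply Octonion.ext <;> simp
  have conj_conj : ∀ x : Octonion ℝ, conj (conj x) = x := fun x => by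
    apply Octonion.ext <;> simp
  have conj_one : conj (1 : Octonion ℝ) = 1 := by
    apply Octonion.ext <;> simp
  have conj_eq : ∀ x : Octonion ℝ, conj x = (2 * dot 1 x) • 1 - x := fun x => by
    apply Octonion.ext <;> apply Quaternion.ext <;> simp [dot_eq]; ring
  have dot_comm : ∀ x y : Octonion ℝ, dot x y = dot y x := fun x y => by
    simp [dot_eq]; ring
  have dot_conj_one : ∀ x : Octonion ℝ, dot 1 (conj x) = dot 1 x := fun x => by
    simp [dot_eq]
  have dot_mul : ∀ x y : Octonion ℝ, dot 1 (x * y) = dot (conj x) y := fun x y => by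
    simp [dot_eq]; ring
  have dot_mul' : ∀ x y : Octonion ℝ, dot (conj x) y = dot x (conj y) := fun x y => by
    simp [dot_eq]
  have f1 : ∀ x y : Octonion ℝ, x * conj y + y * conj x = (2 * dot x y) • 1 := by
    intro x y
    rw [dot_eq]
    apply Octonion.ext <;> apply Quaternion.ext <;> simp <;> ring
  have f2 : ∀ x y : Octonion ℝ, conj x * y + conj y * x = (2 * dot x y) • 1 := by
    intro x y
    rw [dot_eq]
    apply Octonion.ext <;> apply Quaternion.ext <;> simp <;> ring
  change A3Fun (jordanFun X Y) = jordanFun (A3Fun X) Y + jordanFun X (A3Fun Y)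
  apply J1_ext
  all_goals simp only [Prod.fst_add, Prod.snd_add, Pi.add_apply, jordanFun_fst_zero,
    jordanFun_fst_one, jordanFun_fst_two, jordanFun_snd_zero, jordanFun_snd_one,
    jordanFun_snd_two, A3Fun_fst_zero, A3Fun_fst_one, A3Fun_fst_two, A3Fun_snd_zero,
    A3Fun_snd_one, A3Fun_snd_two]
  · simp only [dot_add_right, dot_smul_right, dot_smul_left, dot_conj_one, dot_mul, dot_mul']
    rw [dot_comm (X.2 2) 1, dot_comm (Y.2 0), dot_mul' (X.2 1)]
    ring
  · simp only [dot_add_right, dot_smul_right, dot_smul_left, dot_conj_one, dot_mul, dot_mul']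
    rw [dot_comm (X.2 2) 1, dot_comm (Y.2 0), dot_mul' (X.2 1)]
    ring
  · rw [dot_mul', dot_mul']
    ring
  · simp only [map_add, map_smul, map_neg, conj_mul, conj_conj, conj_one, mul_one', one_mul',
      smul_mul_assoc, mul_smul_comm]
    simp only [conj_eq, mul_sub, sub_mul, mul_one', one_mul', smul_mul_assoc, mul_smul_comm]
    module
  · simp only [map_add, map_sub, map_smul, map_neg, conj_mul, conj_conj, conj_one, mul_one',
      one_mul', smul_mul_assoc, mul_smul_comm]
    simp only [conj_eq, mul_sub, sub_mul, mul_one', one_mul', smul_mul_assoc, mul_smul_comm]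
    module
  · simp only [map_add, map_smul, map_neg, conj_mul, conj_conj, conj_one, mul_one', one_mul',
      smul_mul_assoc, mul_smul_comm]
    linear_combination (norm := module) (-2⁻¹ : ℝ) • f2 (X.2 1) (Y.2 1)
      - (2⁻¹ : ℝ) • f1 (X.2 0) (Y.2 0)

/-- `Ã₃¹(1)` as an element of `𝔣_{4(-20)}`. -/
def A3 : f4 := ⟨LinearMap.toContinuousLinearMap A3Lin, mem_f4_iff_isDerivation.2 isDerivation_A3⟩

theorem A3_ne_zero : A3 ≠ 0 := by
  intro h
  have h1 := congrArg (fun D : f4 => (((D : J1 →L[ℝ] J1) (E 0)).2 2).fst.re) h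
  change ((A3Fun (E 0)).2 2).fst.re = 0 at h1
  rw [A3Fun_snd_two] at h1
  simp [E] at h1

/-- `𝔞 = {t Ã₃¹(1) | t ∈ ℝ}`. -/
def a : Submodule ℝ f4 := Submodule.span ℝ {A3}

/-- The linear functional `α` on `𝔞` with `α(Ã₃¹(1)) = 1`. -/
def alpha : Module.Dual ℝ a :=
  (LinearEquiv.coord ℝ f4 A3 A3_ne_zero).toLinearMap

theorem alpha_A3 : alpha ⟨A3, Submodule.mem_span_singleton_self _⟩ = 1 :=
  LinearEquiv.coord_self ℝ f4 A3 A3_ne_zero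

/-- The centralizer `M` of `𝔞` in `K`. -/
def M : Subgroup F4 where
  carrier := {g | g ∈ K ∧ Ad g A3 = A3}
  mul_mem' {g h} hg hh := ⟨K.mul_mem hg.1 hh.1, by
    change Ad g (Ad h A3) = A3
    rw [hh.2, hg.2]⟩
  one_mem' := ⟨K.one_mem, rfl⟩
  inv_mem' {g} hg := ⟨K.inv_mem hg.1, by
    change (Ad g).symm A3 = A3
    rw [LieEquiv.symm_apply_eq, hg.2]⟩

/-- The centralizer `𝔪` of `𝔞` in `𝔨`. -/
def m : Submodule ℝ f4 where
  carrier := {D | D ∈ k ∧ ⁅D, A3⁆ = 0}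
  add_mem' {D D'} h h' := ⟨k.add_mem h.1 h'.1, by rw [add_lie, h.2, h'.2, add_zero]⟩
  zero_mem' := ⟨k.zero_mem, zero_lie _⟩
  smul_mem' c D h := ⟨k.smul_mem c h.1, by rw [smul_lie, h.2, smul_zero]⟩

/-- The space `𝔤_λ = {X | [H, X] = λ(H) X for all H ∈ 𝔞}`. -/
def rootSpace (l : Module.Dual ℝ a) : Submodule ℝ f4 where
  carrier := {X | ∀ H : a, ⁅(H : f4), X⁆ = l H • X}
  add_mem' {X Y} hX hY H := by rw [lie_add, hX H, hY H, smul_add]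
  zero_mem' H := by rw [lie_zero, smul_zero]
  smul_mem' c X hX H := by rw [lie_smul, hX H, smul_comm]

/-- The set `Σ` of roots of `(𝔣_{4(-20)}, 𝔞)`. -/
def roots : Set (Module.Dual ℝ a) := {l | l ≠ 0 ∧ rootSpace l ≠ ⊥}

/-! ## Signatures of roots and `K_ε` -/

/-- `ε : Σ → {-1, 1}` is a signature of roots. -/
def IsSignature (ε : roots → ℤˣ) : Prop :=
  (∀ l l' : roots, (l' : Module.Dual ℝ a) = -l → ε l = ε l') ∧
  (∀ l l' l'' : roots, (l'' : Module.Dual ℝ a) = l + l' → ε l'' = ε l * ε l')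

/-- The defining conditions of `θ_ε`. -/
def IsThetaEps (ε : roots → ℤˣ) (T : f4 →ₗ[ℝ] f4) : Prop :=
  (∀ l : roots, ∀ X ∈ rootSpace l, T X = ((ε l : ℤ) : ℝ) • theta X) ∧
  (∀ X ∈ a ⊔ m, T X = theta X)

open Classical in
/-- The map `θ_ε`: the linear map with the defining property `IsThetaEps ε` (with the junk value
`0` if there were no such map). -/
def thetaEps (ε : roots → ℤˣ) : f4 →ₗ[ℝ] f4 :=
  if h : ∃ T, IsThetaEps ε T then h.choose else 0

/-- `𝔨_ε`, the fixed points of `θ_ε`. -/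
def kEps (ε : roots → ℤˣ) : Submodule ℝ f4 := LinearMap.eqLocus (thetaEps ε) LinearMap.id

/-- `(K_ε)⁰`, the connected Lie subgroup with the Lie algebra `𝔨_ε`, i.e. the subgroup
generated by the exponentials of the elements of `𝔨_ε`. -/
def KEps0 (ε : roots → ℤˣ) : Subgroup F4 := Subgroup.closure (exp '' (kEps ε : Set f4))

/-- The subset `K_ε = (K_ε)⁰ M` of the group. -/
def KEps (ε : roots → ℤˣ) : Set F4 := (KEps0 ε : Set F4) * (M : Set F4)

end F420

end

noncomputable section

namespace F420

open Octonion

set_option linter.unusedSimpArgs false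

/-! Indices count from 0, as in the code; N denotes ad `A3`, and L_Y is Jordan multiplication by Y.

Since σ_1 = σ_0 σ_2 (`dsigma_one_eq`), dσ̃_1 is θ composed with dσ̃_2. So θ_ε = dσ̃_1 means that
dσ̃_2 acts on each root space by the sign ε and trivially on 𝔞 ⊕ 𝔪. As dσ̃_2 fixes `A3`, it commutes
with N, and the Lie algebra splits into an odd and an even part that N preserves. On the odd part N²
= 1 (`lie_A3_sq_of_odd`), on the even part N³ = 4N (`lie_A3_cube_of_even`). Hence ±α can occur only
in the odd part, and 0, ±2α only in the even part, which is the claim about signs. Both polynomials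
have distinct real roots, so the eigenspaces of N span; with ker N ⊆ 𝔞 ⊕ 𝔪 (`mem_a_sup_m_of_lie_A3`)
this makes θ_ε unique. The two polynomial identities come from writing a derivation as a sum of
three explicit octonionic ones and one that kills every E_i (`exists_rot_decomposition`), and from
computing N on these summands.

On the group side, σ_i is a polynomial in L_{E_i}, so automorphisms that fix E_i commute with σ_i.
Conversely, an automorphism commuting with σ_i preserves the σ_i-fixed vectors, on which L_{E_i} has
its image in the line of E_i; this and idempotency pin down the image of E_i.

It remains to write an element g of the stabilizer of E_1 as an element of (K_ε)⁰ times an element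
of M. The image g E_0 is an idempotent on a hyperbola in the Peirce-0 space of E_1. A hyperbolic
one-parameter group from 𝔨_ε moves it to E_0; the other branch would lead to E_2, which is not in
the orbit of E_0 (`F4_apply_E_zero_ne_E_two`). A compact rotation then brings the image of F_2(1)
back to F_2(1). An automorphism that fixes E_0 and F_2(1) lies in M, because `A3` is 4 [L_{E_0},
L_{F_2(1)}]. -/

/-- The derivation `4 [L_{E₂}, L_{F₁(a)}]` in coordinates. -/
def rot1Fun (a : Octonion ℝ) (X : J1) : J1 :=
  (![0, 2 * dot a (X.2 0), -2 * dot a (X.2 0)],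
   ![(X.1 2 - X.1 1) • a, -conj (X.2 2 * a), conj (a * X.2 1)])

/-- The derivation `4 [L_{E₃}, L_{F₂(a)}]` in coordinates. -/
def rot2Fun (a : Octonion ℝ) (X : J1) : J1 :=
  (![2 * dot a (X.2 1), 0, -2 * dot a (X.2 1)],
   ![-conj (a * X.2 2), (X.1 0 - X.1 2) • a, -conj (X.2 0 * a)])

/-- The derivation `4 [L_{E₁}, L_{F₃(a)}]` in coordinates. -/
def rot3Fun (a : Octonion ℝ) (X : J1) : J1 :=
  (![-2 * dot a (X.2 2), 2 * dot a (X.2 2), 0],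
   ![conj (X.2 1 * a), conj (a * X.2 0), (X.1 1 - X.1 0) • a])

/-! ### Octonion identities -/

theorem dot_comm (x y : Octonion ℝ) : dot x y = dot y x := by
  simp only [dot_eq]; ring

theorem dot_zero_left (x : Octonion ℝ) : dot 0 x = 0 := by simp [dot_eq]
theorem dot_zero_right (x : Octonion ℝ) : dot x 0 = 0 := by simp [dot_eq]

theorem dot_sub_right (x y z : Octonion ℝ) : dot x (y - z) = dot x y - dot x z := by
  simp [dot_eq]; ring

theorem conj_mul (x y : Octonion ℝ) : conj (x * y) = conj y * conj x := by
  apply Octonion.ext <;> simp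

theorem conj_conj (x : Octonion ℝ) : conj (conj x) = x := by
  apply Octonion.ext <;> simp

theorem octonion_one_mul (x : Octonion ℝ) : 1 * x = x := by
  apply Octonion.ext <;> simp

theorem octonion_mul_one (x : Octonion ℝ) : x * 1 = x := by
  apply Octonion.ext <;> simp

/-- Polarization of p̄(pr) = (p|p) r, the form in which alternativity enters the Leibniz rules
below; the next lemma is its mirror image. -/
theorem conj_mul_mul_add (p q r : Octonion ℝ) :
    conj p * (q * r) + conj q * (p * r) = (2 * dot p q) • r := by
  rw [dot_eq]
  apply Octonion.ext <;> apply Quaternion.ext <;> simp <;> ring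

theorem mul_mul_conj_add (p q r : Octonion ℝ) :
    (r * p) * conj q + (r * q) * conj p = (2 * dot p q) • r := by
  rw [dot_eq]
  apply Octonion.ext <;> apply Quaternion.ext <;> simp <;> ring

/-- Cyclic symmetry of the trilinear form Re(x(yz)), which does not see the failure of
associativity. -/
theorem dot_conj_mul (x y z : Octonion ℝ) : dot x (conj (y * z)) = dot y (conj (z * x)) := by
  simp [dot_eq]; ring

section

variable (a : Octonion ℝ) (X : J1)

theorem rot1Fun_fst_zero : (rot1Fun a X).1 0 = 0 := rfl
theorem rot1Fun_fst_one : (rot1Fun a X).1 1 = 2 * dot a (X.2 0) := rfl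
theorem rot1Fun_fst_two : (rot1Fun a X).1 2 = -2 * dot a (X.2 0) := rfl
theorem rot1Fun_snd_zero : (rot1Fun a X).2 0 = (X.1 2 - X.1 1) • a := rfl
theorem rot1Fun_snd_one : (rot1Fun a X).2 1 = -conj (X.2 2 * a) := rfl
theorem rot1Fun_snd_two : (rot1Fun a X).2 2 = conj (a * X.2 1) := rfl

end

section

variable (a : Octonion ℝ) (X : J1)

theorem rot2Fun_fst_zero : (rot2Fun a X).1 0 = 2 * dot a (X.2 1) := rfl
theorem rot2Fun_fst_one : (rot2Fun a X).1 1 = 0 := rfl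
theorem rot2Fun_fst_two : (rot2Fun a X).1 2 = -2 * dot a (X.2 1) := rfl
theorem rot2Fun_snd_zero : (rot2Fun a X).2 0 = -conj (a * X.2 2) := rfl
theorem rot2Fun_snd_one : (rot2Fun a X).2 1 = (X.1 0 - X.1 2) • a := rfl
theorem rot2Fun_snd_two : (rot2Fun a X).2 2 = -conj (X.2 0 * a) := rfl

end

section

variable (a : Octonion ℝ) (X : J1)

theorem rot3Fun_fst_zero : (rot3Fun a X).1 0 = -2 * dot a (X.2 2) := rfl
theorem rot3Fun_fst_one : (rot3Fun a X).1 1 = 2 * dot a (X.2 2) := rfl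
theorem rot3Fun_fst_two : (rot3Fun a X).1 2 = 0 := rfl
theorem rot3Fun_snd_zero : (rot3Fun a X).2 0 = conj (X.2 1 * a) := rfl
theorem rot3Fun_snd_one : (rot3Fun a X).2 1 = conj (a * X.2 0) := rfl
theorem rot3Fun_snd_two : (rot3Fun a X).2 2 = (X.1 1 - X.1 0) • a := rfl

end

/-! ### Three octonionic families of derivations -/

theorem rot1Fun_jordanFun (a : Octonion ℝ) (X Y : J1) :
    rot1Fun a (jordanFun X Y) = jordanFun (rot1Fun a X) Y + jordanFun X (rot1Fun a Y) := by
  -- The diagonal coordinates of the Leibniz rule need only cyclicity of the trilinear form, the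
  -- off-diagonal ones only the polarized alternative laws.
  have c₀ := dot_conj_mul (X.2 0) (Y.2 1) a
  have c₁ := dot_conj_mul (X.2 1) (Y.2 2) a
  have c₂ := dot_conj_mul (X.2 2) (Y.2 0) a
  have c₃ := dot_conj_mul (Y.2 0) (X.2 1) a
  have c₄ := dot_conj_mul (Y.2 1) (X.2 2) a
  have c₅ := dot_conj_mul (Y.2 2) (X.2 0) a
  apply J1_ext
  all_goals simp only [Prod.fst_add, Prod.snd_add, Pi.add_apply, jordanFun_fst_zero,
    jordanFun_fst_one, jordanFun_fst_two,
    jordanFun_snd_zero, jordanFun_snd_one, jordanFun_snd_two, rot1Fun_fst_zero, rot1Fun_fst_one,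
    rot1Fun_fst_two, rot1Fun_snd_zero, rot1Fun_snd_one, rot1Fun_snd_two]
  iterate 3
    simp only [dot_add_right, dot_sub_right, dot_smul_right, dot_smul_left, dot_neg_left,
      dot_neg_right, dot_conj_mul a, dot_comm _ a, dot_comm (conj _)]
    linarith
  all_goals simp only [map_add, map_sub, map_smul, map_neg, conj_mul, conj_conj, mul_add, add_mul,
    mul_sub, sub_mul, mul_neg, neg_mul, smul_mul_assoc, mul_smul_comm]
  · linear_combination (norm := module) (-2⁻¹ : ℝ) • (conj_mul_mul_add (X.2 2) (Y.2 2) a) +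
      (2⁻¹ : ℝ) • (mul_mul_conj_add (X.2 1) (Y.2 1) a)
  · linear_combination (norm := module) (-2⁻¹ : ℝ) • (conj_mul_mul_add a (X.2 0) (Y.2 1)) -
      (2⁻¹ : ℝ) • (conj_mul_mul_add a (Y.2 0) (X.2 1))
  · linear_combination (norm := module) (2⁻¹ : ℝ) • (mul_mul_conj_add a (Y.2 0) (X.2 2)) +
      (2⁻¹ : ℝ) • (mul_mul_conj_add a (X.2 0) (Y.2 2))

theorem rot2Fun_jordanFun (a : Octonion ℝ) (X Y : J1) :
    rot2Fun a (jordanFun X Y) = jordanFun (rot2Fun a X) Y + jordanFun X (rot2Fun a Y) := by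
  have c₀ := dot_conj_mul (X.2 0) (Y.2 1) a
  have c₁ := dot_conj_mul (X.2 1) (Y.2 2) a
  have c₂ := dot_conj_mul (X.2 2) (Y.2 0) a
  have c₃ := dot_conj_mul (Y.2 0) (X.2 1) a
  have c₄ := dot_conj_mul (Y.2 1) (X.2 2) a
  have c₅ := dot_conj_mul (Y.2 2) (X.2 0) a
  apply J1_ext
  all_goals simp only [Prod.fst_add, Prod.snd_add, Pi.add_apply, jordanFun_fst_zero,
    jordanFun_fst_one, jordanFun_fst_two,
    jordanFun_snd_zero, jordanFun_snd_one, jordanFun_snd_two, rot2Fun_fst_zero, rot2Fun_fst_one,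
    rot2Fun_fst_two, rot2Fun_snd_zero, rot2Fun_snd_one, rot2Fun_snd_two]
  iterate 3
    simp only [dot_add_right, dot_sub_right, dot_smul_right, dot_smul_left, dot_neg_left,
      dot_neg_right, dot_conj_mul a, dot_comm _ a, dot_comm (conj _)]
    linarith
  all_goals simp only [map_add, map_sub, map_smul, map_neg, conj_mul, conj_conj, mul_add, add_mul,
    mul_sub, sub_mul, mul_neg, neg_mul, smul_mul_assoc, mul_smul_comm]
  · linear_combination (norm := module) (-2⁻¹ : ℝ) • (mul_mul_conj_add a (Y.2 1) (X.2 0)) -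
      (2⁻¹ : ℝ) • (mul_mul_conj_add a (X.2 1) (Y.2 0))
  · linear_combination (norm := module) (2⁻¹ : ℝ) • (conj_mul_mul_add (X.2 0) (Y.2 0) a) +
      (2⁻¹ : ℝ) • (mul_mul_conj_add (X.2 2) (Y.2 2) a)
  · linear_combination (norm := module) (2⁻¹ : ℝ) • (conj_mul_mul_add a (X.2 1) (Y.2 2)) +
      (2⁻¹ : ℝ) • (conj_mul_mul_add a (Y.2 1) (X.2 2))

theorem rot3Fun_jordanFun (a : Octonion ℝ) (X Y : J1) :
    rot3Fun a (jordanFun X Y) = jordanFun (rot3Fun a X) Y + jordanFun X (rot3Fun a Y) := by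
  have c₀ := dot_conj_mul (X.2 0) (Y.2 1) a
  have c₁ := dot_conj_mul (X.2 1) (Y.2 2) a
  have c₂ := dot_conj_mul (X.2 2) (Y.2 0) a
  have c₃ := dot_conj_mul (Y.2 0) (X.2 1) a
  have c₄ := dot_conj_mul (Y.2 1) (X.2 2) a
  have c₅ := dot_conj_mul (Y.2 2) (X.2 0) a
  apply J1_ext
  all_goals simp only [Prod.fst_add, Prod.snd_add, Pi.add_apply, jordanFun_fst_zero,
    jordanFun_fst_one, jordanFun_fst_two,
    jordanFun_snd_zero, jordanFun_snd_one, jordanFun_snd_two, rot3Fun_fst_zero, rot3Fun_fst_one,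
    rot3Fun_fst_two, rot3Fun_snd_zero, rot3Fun_snd_one, rot3Fun_snd_two]
  iterate 3
    simp only [dot_add_right, dot_sub_right, dot_smul_right, dot_smul_left, dot_neg_left,
      dot_neg_right, dot_conj_mul a, dot_comm _ a, dot_comm (conj _)]
    linarith
  all_goals simp only [map_add, map_sub, map_smul, map_neg, conj_mul, conj_conj, mul_add, add_mul,
    mul_sub, sub_mul, mul_neg, neg_mul, smul_mul_assoc, mul_smul_comm]
  · linear_combination (norm := module) (2⁻¹ : ℝ) • (conj_mul_mul_add a (X.2 2) (Y.2 0)) +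
      (2⁻¹ : ℝ) • (conj_mul_mul_add a (Y.2 2) (X.2 0))
  · linear_combination (norm := module) (-2⁻¹ : ℝ) • (mul_mul_conj_add a (X.2 2) (Y.2 1)) -
      (2⁻¹ : ℝ) • (mul_mul_conj_add a (Y.2 2) (X.2 1))
  · linear_combination (norm := module) (-2⁻¹ : ℝ) • (conj_mul_mul_add (X.2 1) (Y.2 1) a) -
      (2⁻¹ : ℝ) • (mul_mul_conj_add (X.2 0) (Y.2 0) a)

/-- The element of `𝒥¹` whose only coordinate is the octonion `x` in the place `i`. -/
def F (i : Fin 3) (x : Octonion ℝ) : J1 := (0, Pi.single i x)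

theorem jordanFun_comm (X Y : J1) : jordanFun X Y = jordanFun Y X := by
  apply J1_ext
  all_goals simp only [jordanFun_fst_zero, jordanFun_fst_one, jordanFun_fst_two,
    jordanFun_snd_zero, jordanFun_snd_one, jordanFun_snd_two]
  iterate 3 rw [dot_comm (X.2 _), dot_comm (X.2 _)]; ring
  all_goals module

theorem rot1Fun_add (a : Octonion ℝ) (X Y : J1) :
    rot1Fun a (X + Y) = rot1Fun a X + rot1Fun a Y := by
  apply J1_ext
  all_goals simp only [rot1Fun_fst_zero, rot1Fun_fst_one, rot1Fun_fst_two, rot1Fun_snd_zero,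
    rot1Fun_snd_one, rot1Fun_snd_two, Prod.fst_add, Prod.snd_add, Pi.add_apply, dot_add_right,
    add_mul, mul_add, map_add]
  all_goals first | ring1 | module

theorem rot1Fun_smul (a : Octonion ℝ) (c : ℝ) (X : J1) :
    rot1Fun a (c • X) = c • rot1Fun a X := by
  apply J1_ext
  all_goals simp only [rot1Fun_fst_zero, rot1Fun_fst_one, rot1Fun_fst_two, rot1Fun_snd_zero,
    rot1Fun_snd_one, rot1Fun_snd_two, Prod.smul_fst, Prod.smul_snd, Pi.smul_apply,
    dot_smul_right, smul_mul_assoc, mul_smul_comm, map_smul, smul_eq_mul]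
  all_goals first | ring1 | module

theorem rot2Fun_add (a : Octonion ℝ) (X Y : J1) :
    rot2Fun a (X + Y) = rot2Fun a X + rot2Fun a Y := by
  apply J1_ext
  all_goals simp only [rot2Fun_fst_zero, rot2Fun_fst_one, rot2Fun_fst_two, rot2Fun_snd_zero,
    rot2Fun_snd_one, rot2Fun_snd_two, Prod.fst_add, Prod.snd_add, Pi.add_apply, dot_add_right,
    add_mul, mul_add, map_add]
  all_goals first | ring1 | module

theorem rot2Fun_smul (a : Octonion ℝ) (c : ℝ) (X : J1) :
    rot2Fun a (c • X) = c • rot2Fun a X := by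
  apply J1_ext
  all_goals simp only [rot2Fun_fst_zero, rot2Fun_fst_one, rot2Fun_fst_two, rot2Fun_snd_zero,
    rot2Fun_snd_one, rot2Fun_snd_two, Prod.smul_fst, Prod.smul_snd, Pi.smul_apply,
    dot_smul_right, smul_mul_assoc, mul_smul_comm, map_smul, smul_eq_mul]
  all_goals first | ring1 | module

theorem rot3Fun_add (a : Octonion ℝ) (X Y : J1) :
    rot3Fun a (X + Y) = rot3Fun a X + rot3Fun a Y := by
  apply J1_ext
  all_goals simp only [rot3Fun_fst_zero, rot3Fun_fst_one, rot3Fun_fst_two, rot3Fun_snd_zero,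
    rot3Fun_snd_one, rot3Fun_snd_two, Prod.fst_add, Prod.snd_add, Pi.add_apply, dot_add_right,
    add_mul, mul_add, map_add]
  all_goals first | ring1 | module

theorem rot3Fun_smul (a : Octonion ℝ) (c : ℝ) (X : J1) :
    rot3Fun a (c • X) = c • rot3Fun a X := by
  apply J1_ext
  all_goals simp only [rot3Fun_fst_zero, rot3Fun_fst_one, rot3Fun_fst_two, rot3Fun_snd_zero,
    rot3Fun_snd_one, rot3Fun_snd_two, Prod.smul_fst, Prod.smul_snd, Pi.smul_apply,
    dot_smul_right, smul_mul_assoc, mul_smul_comm, map_smul, smul_eq_mul]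
  all_goals first | ring1 | module

/-- The element of `𝔣_{4(-20)}` given by a linear map with the Leibniz rule. -/
def derivationOf (f : J1 → J1) (h₁ : ∀ X Y, f (X + Y) = f X + f Y)
    (h₂ : ∀ (c : ℝ) X, f (c • X) = c • f X)
    (h₃ : ∀ X Y, f (jordanFun X Y) = jordanFun (f X) Y + jordanFun X (f Y)) : f4 :=
  ⟨LinearMap.toContinuousLinearMap { toFun := f, map_add' := h₁, map_smul' := h₂ },
    mem_f4_iff_isDerivation.2 h₃⟩

/-- `4 [L_{E₂}, L_{F₁(a)}]` as an element of `𝔣_{4(-20)}`. -/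
def rot1 (a : Octonion ℝ) : f4 :=
  derivationOf (rot1Fun a) (rot1Fun_add a) (rot1Fun_smul a) (rot1Fun_jordanFun a)

/-- `4 [L_{E₃}, L_{F₂(a)}]` as an element of `𝔣_{4(-20)}`. -/
def rot2 (a : Octonion ℝ) : f4 :=
  derivationOf (rot2Fun a) (rot2Fun_add a) (rot2Fun_smul a) (rot2Fun_jordanFun a)

/-- `4 [L_{E₁}, L_{F₃(a)}]` as an element of `𝔣_{4(-20)}`. -/
def rot3 (a : Octonion ℝ) : f4 :=
  derivationOf (rot3Fun a) (rot3Fun_add a) (rot3Fun_smul a) (rot3Fun_jordanFun a)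

theorem rot1_apply (a : Octonion ℝ) (X : J1) : (rot1 a).1 X = rot1Fun a X := rfl
theorem rot2_apply (a : Octonion ℝ) (X : J1) : (rot2 a).1 X = rot2Fun a X := rfl
theorem rot3_apply (a : Octonion ℝ) (X : J1) : (rot3 a).1 X = rot3Fun a X := rfl
theorem A3_apply (X : J1) : A3.1 X = A3Fun X := rfl

theorem f4_ext {D D' : f4} (h : ∀ X, D.1 X = D'.1 X) : D = D' :=
  Subtype.ext (ContinuousLinearMap.ext h)

theorem lie_apply (D D' : f4) (X : J1) : (⁅D, D'⁆ : f4).1 X = D.1 (D'.1 X) - D'.1 (D.1 X) := rfl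
theorem f4_add_apply (D D' : f4) (X : J1) : (D + D').1 X = D.1 X + D'.1 X := rfl
theorem f4_sub_apply (D D' : f4) (X : J1) : (D - D').1 X = D.1 X - D'.1 X := rfl
theorem f4_neg_apply (D : f4) (X : J1) : (-D).1 X = -D.1 X := rfl
theorem f4_smul_apply (c : ℝ) (D : f4) (X : J1) : (c • D).1 X = c • D.1 X := rfl
theorem f4_zero_apply (X : J1) : (0 : f4).1 X = 0 := rfl

theorem f4_leibniz (D : f4) (X Y : J1) :
    D.1 (jordanFun X Y) = jordanFun (D.1 X) Y + jordanFun X (D.1 Y) :=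
  mem_f4_iff_isDerivation.1 D.2 X Y

/-! ### Brackets with the generator of 𝔞 -/

theorem conj_eq (x : Octonion ℝ) : conj x = (2 * dot 1 x) • 1 - x := by
  apply Octonion.ext <;> apply Quaternion.ext <;> simp [dot_eq]; ring

theorem dot_conj_right (x y : Octonion ℝ) : dot x (conj y) = dot (conj x) y := by
  simp [dot_eq]

theorem dot_one_mul (x y : Octonion ℝ) : dot 1 (x * y) = dot (conj x) y := by
  simp [dot_eq]; ring

/-- Polarization of the quadratic equation x² = 2(1|x) x - (x|x) 1. -/
theorem mul_add_mul_comm (x y : Octonion ℝ) :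
    x * y + y * x = (2 * dot 1 x) • y + (2 * dot 1 y) • x - (2 * dot x y) • 1 := by
  rw [dot_eq, dot_eq, dot_eq]
  apply Octonion.ext <;> apply Quaternion.ext <;> simp <;> ring

theorem conj_one : conj (1 : Octonion ℝ) = 1 := by
  apply Octonion.ext <;> simp

theorem dot_one_one : dot (1 : Octonion ℝ) 1 = 1 := by simp [dot_eq]

theorem lie_A3_rot1 (a : Octonion ℝ) : ⁅A3, rot1 a⁆ = -rot2 (conj a) := by
  refine f4_ext fun X => ?_
  rw [lie_apply, f4_neg_apply, A3_apply, rot1_apply, rot1_apply, A3_apply, rot2_apply]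
  apply J1_ext
  all_goals simp only [Prod.fst_sub, Prod.snd_sub, Pi.sub_apply, Prod.fst_neg, Prod.snd_neg,
    Pi.neg_apply, A3Fun_fst_zero, A3Fun_fst_one, A3Fun_fst_two, A3Fun_snd_zero, A3Fun_snd_one,
    A3Fun_snd_two, rot1Fun_fst_zero, rot1Fun_fst_one, rot1Fun_fst_two, rot1Fun_snd_zero,
    rot1Fun_snd_one, rot1Fun_snd_two, rot2Fun_fst_zero, rot2Fun_fst_one, rot2Fun_fst_two,
    rot2Fun_snd_zero, rot2Fun_snd_one, rot2Fun_snd_two]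
  iterate 3
    simp only [dot_conj_right, dot_one_mul, conj_one, conj_conj]
    ring
  all_goals
    simp only [map_neg, map_smul, map_sub, conj_mul, conj_conj]
    simp only [mul_sub, sub_mul, smul_mul_assoc, mul_smul_comm,
      octonion_one_mul, octonion_mul_one, conj_eq, dot_one_one]
  · module
  · module
  · linear_combination (norm := module) mul_add_mul_comm a (X.2 0)

theorem lie_A3_rot2 (a : Octonion ℝ) : ⁅A3, rot2 a⁆ = -rot1 (conj a) := by
  refine f4_ext fun X => ?_
  rw [lie_apply, f4_neg_apply, A3_apply, rot2_apply, rot2_apply, A3_apply, rot1_apply]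
  apply J1_ext
  all_goals simp only [Prod.fst_sub, Prod.snd_sub, Pi.sub_apply, Prod.fst_neg, Prod.snd_neg,
    Pi.neg_apply, A3Fun_fst_zero, A3Fun_fst_one, A3Fun_fst_two, A3Fun_snd_zero, A3Fun_snd_one,
    A3Fun_snd_two, rot1Fun_fst_zero, rot1Fun_fst_one, rot1Fun_fst_two, rot1Fun_snd_zero,
    rot1Fun_snd_one, rot1Fun_snd_two, rot2Fun_fst_zero, rot2Fun_fst_one, rot2Fun_fst_two,
    rot2Fun_snd_zero, rot2Fun_snd_one, rot2Fun_snd_two]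
  iterate 3
    simp only [dot_conj_right, dot_neg_right, conj_mul, dot_one_mul, conj_one, conj_conj,
      dot_comm _ a]
    ring
  all_goals
    simp only [map_neg, map_smul, map_sub, conj_mul, conj_conj]
    simp only [mul_sub, sub_mul, smul_mul_assoc, mul_smul_comm,
      octonion_one_mul, octonion_mul_one, conj_eq, dot_one_one]
  · module
  · module
  · linear_combination (norm := module) - mul_add_mul_comm a (X.2 1)

/-- `[A₃(1), A₃(c)]` in coordinates, for `c` orthogonal to `1`. -/
theorem lie_A3_rot3_apply {c : Octonion ℝ} (hc : dot 1 c = 0) (X : J1) :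
    (⁅A3, rot3 c⁆ : f4).1 X = (0, ![(2 : ℝ) • (c * X.2 0), (2 : ℝ) • (X.2 1 * c),
      (4 * dot c (X.2 2)) • 1 - (4 * dot 1 (X.2 2)) • c]) := by
  have hc' : conj c = -c := by rw [conj_eq, hc]; module
  rw [lie_apply, A3_apply, rot3_apply, rot3_apply, A3_apply]
  apply J1_ext
  all_goals simp only [Prod.fst_sub, Prod.snd_sub, Pi.sub_apply, Prod.fst_neg, Prod.snd_neg,
    Pi.neg_apply, A3Fun_fst_zero, A3Fun_fst_one, A3Fun_fst_two, A3Fun_snd_zero, A3Fun_snd_one,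
    A3Fun_snd_two, rot3Fun_fst_zero, rot3Fun_fst_one, rot3Fun_fst_two, rot3Fun_snd_zero,
    rot3Fun_snd_one, rot3Fun_snd_two, Matrix.cons_val_zero, Matrix.cons_val_one, Matrix.cons_val,
    Pi.zero_apply]
  iterate 3
    try simp only [dot_smul_right, dot_comm c 1, hc]
    ring
  all_goals
    try simp only [conj_mul, conj_conj, hc', map_neg, neg_neg, neg_mul, mul_neg]
    module

theorem lie_A3_lie_A3_rot1 (a : Octonion ℝ) : ⁅A3, ⁅A3, rot1 a⁆⁆ = rot1 a := by
  rw [lie_A3_rot1, lie_neg, lie_A3_rot2, conj_conj, neg_neg]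

theorem lie_A3_lie_A3_rot2 (a : Octonion ℝ) : ⁅A3, ⁅A3, rot2 a⁆⁆ = rot2 a := by
  rw [lie_A3_rot2, lie_neg, lie_A3_rot1, conj_conj, neg_neg]

theorem lie_A3_lie_A3_rot3 {c : Octonion ℝ} (hc : dot 1 c = 0) :
    ⁅A3, ⁅A3, rot3 c⁆⁆ = (4 : ℝ) • rot3 c := by
  have hc' : conj c = -c := by rw [conj_eq, hc]; module
  refine f4_ext fun X => ?_
  rw [lie_apply, lie_A3_rot3_apply hc, lie_A3_rot3_apply hc, f4_smul_apply, A3_apply, A3_apply,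
    rot3_apply]
  apply J1_ext
  all_goals simp only [Prod.fst_sub, Prod.snd_sub, Pi.sub_apply, Prod.smul_fst, Prod.smul_snd,
    Pi.smul_apply, A3Fun_fst_zero, A3Fun_fst_one, A3Fun_fst_two, A3Fun_snd_zero, A3Fun_snd_one,
    A3Fun_snd_two, rot3Fun_fst_zero, rot3Fun_fst_one, rot3Fun_fst_two, rot3Fun_snd_zero,
    rot3Fun_snd_one, rot3Fun_snd_two, Matrix.cons_val_zero, Matrix.cons_val_one, Matrix.cons_val,
    Pi.zero_apply, smul_eq_mul, dot_sub_right, dot_smul_right, dot_one_one, hc, map_smul, conj_mul,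
    hc', dot_comm c 1, neg_mul, mul_neg]
  all_goals first | ring1 | module

/-- The direction c = 1 gives `A3` itself, which N kills; only imaginary c contribute to the
eigenvalues ±2. -/
theorem rot3_eq (c : Octonion ℝ) : rot3 c = dot 1 c • A3 + rot3 (c - dot 1 c • 1) := by
  refine f4_ext fun X => ?_
  rw [f4_add_apply, f4_smul_apply, A3_apply, rot3_apply, rot3_apply]
  apply J1_ext
  all_goals simp only [Prod.fst_add, Prod.snd_add, Pi.add_apply, Prod.smul_fst, Prod.smul_snd,
    Pi.smul_apply, A3Fun_fst_zero, A3Fun_fst_one, A3Fun_fst_two, A3Fun_snd_zero, A3Fun_snd_one,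
    A3Fun_snd_two, rot3Fun_fst_zero, rot3Fun_fst_one, rot3Fun_fst_two, rot3Fun_snd_zero,
    rot3Fun_snd_one, rot3Fun_snd_two, smul_eq_mul, sub_eq_add_neg, dot_add_left, dot_neg_left,
    dot_smul_left, conj_mul, map_add, map_neg, map_smul, conj_one, add_mul, mul_add, mul_neg,
    neg_mul, octonion_mul_one, octonion_one_mul, smul_mul_assoc, mul_smul_comm]
  all_goals first | ring1 | module

theorem dot_one_sub (c : Octonion ℝ) : dot 1 (c - dot 1 c • 1) = 0 := by
  rw [dot_sub_right, dot_smul_right, dot_one_one]; ring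

/-! ### The generator and the involutions in terms of Jordan multiplications -/

/-- This inner form reduces commuting with `A3` to conditions on the two vectors E_0 and F_2(1), for
derivations and for automorphisms alike. -/
theorem A3Fun_eq_jordanFun (X : J1) : A3Fun X = (4 : ℝ) •
    (jordanFun (E 0) (jordanFun (F 2 1) X) - jordanFun (F 2 1) (jordanFun (E 0) X)) := by
  apply J1_ext
  all_goals simp [A3Fun, jordanFun, E, F, dot_zero_left, dot_zero_right, dot_neg_right,
    dot_smul_right, octonion_one_mul, octonion_mul_one, smul_smul]
  all_goals first | ring1 | module

/-- The eigenvalues of L_{E_i} are 0, 1/2, 1, and σ_i is -1 exactly on the eigenspace for 1/2. There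
L - L² is 1/4, elsewhere 0, which gives the factor 8. -/
theorem sigma_apply_eq_jordanFun (i : Fin 3) (X : J1) : (sigma i : J1 ≃L[ℝ] J1) X =
    X - (8 : ℝ) • (jordanFun (E i) X - jordanFun (E i) (jordanFun (E i) X)) := by
  rw [sigma_apply]
  fin_cases i
  all_goals
    apply J1_ext
    all_goals simp [jordanFun, E, dot_zero_left, dot_zero_right, smul_smul]
    all_goals first | done | ring1 | module

theorem f4_jordanFun_of_apply_eq_zero {D : f4} {Y : J1} (h : D.1 Y = 0) (X : J1) :
    D.1 (jordanFun Y X) = jordanFun Y (D.1 X) := by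
  have h0 : jordanFun 0 X = 0 := by rw [← jordan_apply, map_zero, LinearMap.zero_apply]
  rw [f4_leibniz, h, h0, zero_add]

theorem F4_jordanFun_of_apply_eq {g : F4} {Y : J1} (h : g.1 Y = Y) (X : J1) :
    g.1 (jordanFun Y X) = jordanFun Y (g.1 X) :=
  (g.2 Y X).trans (by rw [h]; rfl)

theorem lie_A3_eq_zero {D : f4} (h0 : D.1 (E 0) = 0) (h1 : D.1 (F 2 1) = 0) : ⁅A3, D⁆ = 0 := by
  refine f4_ext fun X => ?_
  rw [lie_apply, A3_apply, A3_apply, A3Fun_eq_jordanFun X, map_smul, map_sub,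
    f4_jordanFun_of_apply_eq_zero h0, f4_jordanFun_of_apply_eq_zero h1,
    f4_jordanFun_of_apply_eq_zero h1, f4_jordanFun_of_apply_eq_zero h0, ← A3Fun_eq_jordanFun,
    sub_self, f4_zero_apply]

theorem Ad_apply (g : F4) (D : f4) (X : J1) : (Ad g D).1 X = g.1 (D.1 (g.1.symm X)) := rfl

theorem Ad_A3_eq {g : F4} (h0 : g.1 (E 0) = E 0) (h1 : g.1 (F 2 1) = F 2 1) : Ad g A3 = A3 := by
  refine f4_ext fun X => ?_
  rw [Ad_apply, A3_apply, A3_apply, A3Fun_eq_jordanFun, map_smul, map_sub,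
    F4_jordanFun_of_apply_eq h0, F4_jordanFun_of_apply_eq h1,
    F4_jordanFun_of_apply_eq h1, F4_jordanFun_of_apply_eq h0,
    ContinuousLinearEquiv.apply_symm_apply, ← A3Fun_eq_jordanFun]

theorem sigma_sigma_apply (i : Fin 3) (X : J1) : (sigma i).1 ((sigma i).1 X) = X :=
  sigmaLin_involutive i X

theorem dsigma_apply (i : Fin 3) (D : f4) (X : J1) :
    (dsigma i D).1 X = (sigma i).1 (D.1 ((sigma i).1 X)) := rfl

theorem dsigma_dsigma (i : Fin 3) (D : f4) : dsigma i (dsigma i D) = D := by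
  refine f4_ext fun X => ?_
  rw [dsigma_apply, dsigma_apply, sigma_sigma_apply, sigma_sigma_apply]

theorem dsigma_eq_iff {i : Fin 3} {D : f4} :
    dsigma i D = D ↔ ∀ X, (sigma i).1 (D.1 X) = D.1 ((sigma i).1 X) := by
  constructor
  · intro h X
    conv_rhs => rw [← h, dsigma_apply, sigma_sigma_apply]
  · intro h
    refine f4_ext fun X => ?_
    rw [dsigma_apply, h, sigma_sigma_apply]

theorem dsigma_eq_self {i : Fin 3} {D : f4} (h : D.1 (E i) = 0) : dsigma i D = D := by
  rw [dsigma_eq_iff]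
  intro X
  rw [sigma_apply_eq_jordanFun, sigma_apply_eq_jordanFun, map_sub, map_smul, map_sub,
    f4_jordanFun_of_apply_eq_zero h, f4_jordanFun_of_apply_eq_zero h,
    f4_jordanFun_of_apply_eq_zero h]

theorem sigma_comm_of_apply_E {i : Fin 3} {g : F4} (h : g.1 (E i) = E i) (X : J1) :
    (sigma i).1 (g.1 X) = g.1 ((sigma i).1 X) := by
  rw [sigma_apply_eq_jordanFun, sigma_apply_eq_jordanFun, map_sub, map_smul, map_sub,
    F4_jordanFun_of_apply_eq h, F4_jordanFun_of_apply_eq h, F4_jordanFun_of_apply_eq h]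

theorem mem_fixedSubgroup_iff {i : Fin 3} {g : F4} :
    g ∈ fixedSubgroup (sigmaTilde i) ↔ ∀ X, (sigma i).1 (g.1 X) = g.1 ((sigma i).1 X) := by
  have h : ∀ X, (sigmaTilde i g).1 X = (sigma i).1 (g.1 ((sigma i).1 X)) := fun X => rfl
  constructor
  · intro hg X
    change sigmaTilde i g = g at hg
    conv_rhs => rw [← hg, h, sigma_sigma_apply]
  · intro hg
    refine Subtype.ext (ContinuousLinearEquiv.ext (funext fun X => ?_))
    exact (h X).trans (by rw [hg, sigma_sigma_apply])

/-- This turns the comparison of dσ̃_1 with θ into a parity question for dσ̃_2. -/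
theorem dsigma_one_eq (D : f4) : dsigma 1 D = dsigma 0 (dsigma 2 D) := by
  have h : ∀ X, (sigma 1).1 X = (sigma 0).1 ((sigma 2).1 X) := by
    intro X
    simp only [sigma_apply]
    apply J1_ext <;> simp
  have h' : ∀ X, (sigma 1).1 X = (sigma 2).1 ((sigma 0).1 X) := by
    intro X
    simp only [sigma_apply]
    apply J1_ext <;> simp
  refine f4_ext fun X => ?_
  rw [dsigma_apply, dsigma_apply, dsigma_apply, ← h', ← h]

theorem dsigma_A3_two : dsigma 2 A3 = A3 := by
  refine dsigma_eq_self (J1_ext ?_ ?_ ?_ ?_ ?_ ?_) <;>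
    simp [A3_apply, A3Fun, E, dot_zero_right]

section

variable (a : Octonion ℝ)

theorem dsigma_two_rot1 : dsigma 2 (rot1 a) = -rot1 a := by
  refine f4_ext fun X => ?_
  rw [dsigma_apply, f4_neg_apply, rot1_apply, rot1_apply, sigma_apply, sigma_apply]
  apply J1_ext <;> simp [rot1Fun, dot_neg_right]

theorem dsigma_two_rot2 : dsigma 2 (rot2 a) = -rot2 a := by
  refine f4_ext fun X => ?_
  rw [dsigma_apply, f4_neg_apply, rot2_apply, rot2_apply, sigma_apply, sigma_apply]
  apply J1_ext <;> simp [rot2Fun, dot_neg_right]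

theorem dsigma_two_rot3 : dsigma 2 (rot3 a) = rot3 a := by
  refine f4_ext fun X => ?_
  rw [dsigma_apply, rot3_apply, rot3_apply, sigma_apply, sigma_apply]
  apply J1_ext <;> simp [rot3Fun, dot_neg_right]

theorem dsigma_zero_rot1 : dsigma 0 (rot1 a) = rot1 a := by
  refine f4_ext fun X => ?_
  rw [dsigma_apply, rot1_apply, rot1_apply, sigma_apply, sigma_apply]
  apply J1_ext <;> simp [rot1Fun, dot_neg_right]

theorem dsigma_zero_rot2 : dsigma 0 (rot2 a) = -rot2 a := by
  refine f4_ext fun X => ?_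
  rw [dsigma_apply, f4_neg_apply, rot2_apply, rot2_apply, sigma_apply, sigma_apply]
  apply J1_ext <;> simp [rot2Fun, dot_neg_right]

theorem dsigma_zero_rot3 : dsigma 0 (rot3 a) = -rot3 a := by
  refine f4_ext fun X => ?_
  rw [dsigma_apply, f4_neg_apply, rot3_apply, rot3_apply, sigma_apply, sigma_apply]
  apply J1_ext <;> simp [rot3Fun, dot_neg_right]

end

theorem dsigma_zero_A3 : dsigma 0 A3 = -A3 := by
  refine f4_ext fun X => ?_
  rw [dsigma_apply, f4_neg_apply, A3_apply, A3_apply, sigma_apply, sigma_apply]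
  apply J1_ext <;> simp [A3Fun, dot_neg_right]

/-! ### Peirce spaces and the decomposition of derivations -/

theorem jordanFun_E_zero (X : J1) : jordanFun (E 0) X =
    (![X.1 0, 0, 0], ![0, (2⁻¹ : ℝ) • X.2 1, (2⁻¹ : ℝ) • X.2 2]) := by
  apply J1_ext <;> simp [jordanFun, E, dot_zero_left]

theorem jordanFun_E_one (X : J1) : jordanFun (E 1) X =
    (![0, X.1 1, 0], ![(2⁻¹ : ℝ) • X.2 0, 0, (2⁻¹ : ℝ) • X.2 2]) := by
  apply J1_ext <;> simp [jordanFun, E, dot_zero_left]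

theorem jordanFun_E_two (X : J1) : jordanFun (E 2) X =
    (![0, 0, X.1 2], ![(2⁻¹ : ℝ) • X.2 0, (2⁻¹ : ℝ) • X.2 1, 0]) := by
  apply J1_ext <;> simp [jordanFun, E, dot_zero_left]

theorem jordanFun_E_self (i : Fin 3) : jordanFun (E i) (E i) = E i := by
  fin_cases i
  · simp only [Fin.zero_eta, jordanFun_E_zero]; apply J1_ext <;> simp [E]
  · simp only [Fin.mk_one, jordanFun_E_one]; apply J1_ext <;> simp [E]
  · simp only [Fin.reduceFinMk, jordanFun_E_two]; apply J1_ext <;> simp [E]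

theorem jordanFun_one (X : J1) : jordanFun (E 0 + E 1 + E 2) X = X := by
  apply J1_ext <;> simp [jordanFun, E, dot_zero_left, smul_smul]
  all_goals module

theorem E_fst (i j : Fin 3) : (E i).1 j = (Pi.single i 1 : Fin 3 → ℝ) j := rfl
theorem E_snd (i j : Fin 3) : (E i).2 j = 0 := rfl

theorem dsigma_map_zero (i : Fin 3) : dsigma i 0 = 0 :=
  f4_ext fun X => by rw [dsigma_apply, f4_zero_apply, map_zero, f4_zero_apply]

theorem dsigma_map_sub (i : Fin 3) (D D' : f4) :
    dsigma i (D - D') = dsigma i D - dsigma i D' :=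
  f4_ext fun X => by
    rw [dsigma_apply, f4_sub_apply, map_sub, f4_sub_apply, dsigma_apply, dsigma_apply]

theorem eq_zero_of_two_smul {D : f4} (h : (2 : ℝ) • D = 0) : D = 0 :=
  (smul_eq_zero.1 h).resolve_left two_ne_zero

/-- Applying D to E_i ∘ E_i = E_i places D E_i in the Peirce space of E_i for 1/2. -/
theorem f4_apply_E (D : f4) (i : Fin 3) :
    D.1 (E i) = (2 : ℝ) • jordanFun (E i) (D.1 (E i)) := by
  conv_lhs => rw [← jordanFun_E_self i, f4_leibniz, jordanFun_comm (D.1 (E i))]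
  module

theorem f4_apply_one (D : f4) : D.1 (E 0) + D.1 (E 1) + D.1 (E 2) = 0 := by
  rw [← map_add, ← map_add]
  have h := f4_leibniz D (E 0 + E 1 + E 2) (E 0 + E 1 + E 2)
  rw [jordanFun_comm (D.1 _), jordanFun_one, jordanFun_one] at h
  simpa using h

theorem f4_apply_E_zero (D : f4) :
    (D.1 (E 0)).1 = 0 ∧ (D.1 (E 0)).2 0 = 0 := by
  have h := f4_apply_E D 0
  rw [jordanFun_E_zero] at h
  refine ⟨funext fun i => ?_, ?_⟩
  · have := congrFun (congrArg Prod.fst h) i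
    fin_cases i <;> simp at this ⊢ <;> linarith
  · simpa using congrFun (congrArg Prod.snd h) 0

theorem f4_apply_E_one (D : f4) :
    (D.1 (E 1)).1 = 0 ∧ (D.1 (E 1)).2 1 = 0 := by
  have h := f4_apply_E D 1
  rw [jordanFun_E_one] at h
  refine ⟨funext fun i => ?_, ?_⟩
  · have := congrFun (congrArg Prod.fst h) i
    fin_cases i <;> simp at this ⊢ <;> linarith
  · simpa using congrFun (congrArg Prod.snd h) 1

theorem f4_apply_E_two (D : f4) :
    (D.1 (E 2)).1 = 0 ∧ (D.1 (E 2)).2 2 = 0 := by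
  have h := f4_apply_E D 2
  rw [jordanFun_E_two] at h
  refine ⟨funext fun i => ?_, ?_⟩
  · have := congrFun (congrArg Prod.fst h) i
    fin_cases i <;> simp at this ⊢ <;> linarith
  · simpa using congrFun (congrArg Prod.snd h) 2

/-- Each D E_i has only two octonion coordinates, and D kills the unit E_0 + E_1 + E_2. So the six
coordinates are ± three octonions, which the three families of derivations realize. -/
theorem exists_rot_decomposition (D : f4) : ∃ (a b c : Octonion ℝ) (D₀ : f4),
    D = rot1 a + rot2 b + rot3 c + D₀ ∧ ∀ i, D₀.1 (E i) = 0 := by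
  obtain ⟨p0, q0⟩ := f4_apply_E_zero D
  obtain ⟨p1, q1⟩ := f4_apply_E_one D
  obtain ⟨p2, q2⟩ := f4_apply_E_two D
  have hs := f4_apply_one D
  have s0 := congrArg (fun X : J1 => X.2 0) hs
  have s1 := congrArg (fun X : J1 => X.2 1) hs
  have s2 := congrArg (fun X : J1 => X.2 2) hs
  simp only [Prod.snd_add, Pi.add_apply, q0, q1, q2, Prod.snd_zero, Pi.zero_apply, add_zero,
    zero_add] at s0 s1 s2
  set a := (D.1 (E 2)).2 0 with ha
  set b := (D.1 (E 0)).2 1 with hb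
  set c := (D.1 (E 1)).2 2 with hc
  have s0' : (D.1 (E 1)).2 0 = -a := eq_neg_of_add_eq_zero_left s0
  have s1' : (D.1 (E 2)).2 1 = -b := eq_neg_of_add_eq_zero_right s1
  have s2' : (D.1 (E 0)).2 2 = -c := eq_neg_of_add_eq_zero_left s2
  refine ⟨a, b, c, D - (rot1 a + rot2 b + rot3 c), by abel, fun i => ?_⟩
  rw [f4_sub_apply, f4_add_apply, f4_add_apply, rot1_apply, rot2_apply, rot3_apply]
  fin_cases i
  all_goals
    apply J1_ext <;> simp [rot1Fun, rot2Fun, rot3Fun, E_fst, E_snd, dot_zero_right,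
      p0, p1, p2, q0, q1, q2,
      s0', s1', s2', ← ha, ← hb, ← hc]

theorem F2_of_apply {X : J1} (h0 : jordanFun (E 0) X = (2⁻¹ : ℝ) • X)
    (h1 : jordanFun (E 1) X = (2⁻¹ : ℝ) • X) : X = F 2 (X.2 2) := by
  rw [jordanFun_E_zero] at h0
  rw [jordanFun_E_one] at h1
  have a0 := congrArg (fun X : J1 => X.1 0) h1
  have a1 := congrArg (fun X : J1 => X.1 1) h0
  have a2 := congrArg (fun X : J1 => X.1 2) h0
  have b0 := (congrArg (fun X : J1 => X.2 0) h0).symm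
  have b1 := (congrArg (fun X : J1 => X.2 1) h1).symm
  simp at a0 a1 a2 b0 b1
  apply J1_ext <;> simp [F, a0, a1, a2, b0, b1]

theorem jordanFun_E_zero_F (x : Octonion ℝ) :
    jordanFun (E 0) (F 2 x) = (2⁻¹ : ℝ) • F 2 x := by
  rw [jordanFun_E_zero]; apply J1_ext <;> simp [F]

theorem jordanFun_E_one_F (x : Octonion ℝ) :
    jordanFun (E 1) (F 2 x) = (2⁻¹ : ℝ) • F 2 x := by
  rw [jordanFun_E_one]; apply J1_ext <;> simp [F]

theorem jordanFun_F_F (x y : Octonion ℝ) :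
    jordanFun (F 2 x) (F 2 y) = -(dot x y) • (E 0 + E 1) := by
  apply J1_ext <;> simp [jordanFun, E, F, dot_zero_left]

/-- F_2 is the common Peirce space for 1/2 of E_0 and E_1, so D preserves it. Orthogonality to 1
follows from applying D to F_2(1) ∘ F_2(1) = -(E_0 + E_1), whose right side D kills. -/
theorem f4_apply_F {D : f4} (h : ∀ i, D.1 (E i) = 0) :
    ∃ d, D.1 (F 2 1) = F 2 d ∧ dot 1 d = 0 := by
  refine ⟨(D.1 (F 2 1)).2 2, F2_of_apply ?_ ?_, ?_⟩
  · rw [← f4_jordanFun_of_apply_eq_zero (h 0), jordanFun_E_zero_F, map_smul]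
  · rw [← f4_jordanFun_of_apply_eq_zero (h 1), jordanFun_E_one_F, map_smul]
  · have h1 := f4_leibniz D (F 2 1) (F 2 1)
    rw [jordanFun_comm (D.1 _), jordanFun_F_F, map_smul, map_add, h, h] at h1
    have h2 := congrArg (fun X : J1 => X.1 0) h1
    simpa [jordanFun, F, dot_zero_left, ← two_mul] using h2

theorem lie_A3_rot3_E {c : Octonion ℝ} (hc : dot 1 c = 0) (i : Fin 3) :
    (⁅A3, rot3 c⁆ : f4).1 (E i) = 0 := by
  rw [lie_A3_rot3_apply hc]
  apply J1_ext <;> simp [E, dot_zero_right]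

theorem lie_A3_rot3_F {c : Octonion ℝ} (hc : dot 1 c = 0) (x : Octonion ℝ) :
    (⁅A3, rot3 c⁆ : f4).1 (F 2 x) = F 2 ((4 * dot c x) • 1 - (4 * dot 1 x) • c) := by
  rw [lie_A3_rot3_apply hc]
  apply J1_ext <;> simp [F, dot_zero_right]

/-- A derivation that kills the `E_i` is the sum of an element of `𝔪` and of some
`[A₃(1), A₃(d)]`. -/
theorem exists_decomposition_of_apply_E {D : f4} (h : ∀ i, D.1 (E i) = 0) :
    ∃ (d : Octonion ℝ) (D₁ : f4), dot 1 d = 0 ∧ D = ⁅A3, rot3 d⁆ + D₁ ∧ (∀ i, D₁.1 (E i) = 0) ∧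
      ⁅A3, D₁⁆ = 0 := by
  obtain ⟨d, hd, hd1⟩ := f4_apply_F h
  -- For imaginary c, [A₃(1), A₃(c)] sends F_2(1) to -4 F_2(c). Hence c = -d/4 reproduces the action
  -- of D on F_2(1), and the remainder fixes what is needed to commute with `A3`.
  have hd2 : dot 1 ((-4⁻¹ : ℝ) • d) = 0 := by rw [dot_smul_right, hd1, mul_zero]
  have hE : ∀ i, (D - ⁅A3, rot3 ((-4⁻¹ : ℝ) • d)⁆).1 (E i) = 0 := fun i => by
    rw [f4_sub_apply, h, lie_A3_rot3_E hd2, sub_zero]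
  refine ⟨(-4⁻¹ : ℝ) • d, D - ⁅A3, rot3 ((-4⁻¹ : ℝ) • d)⁆, hd2, by abel, hE,
    lie_A3_eq_zero (hE 0) ?_⟩
  rw [f4_sub_apply, hd, lie_A3_rot3_F hd2, dot_comm _ 1, hd2, dot_one_one]
  apply J1_ext <;> simp [F, smul_smul]

/-! ### Spectrum and kernel of N on the odd and even parts -/

/-- Oddness removes the summands `rot3 c` and D₀, and N exchanges the families `rot1` and `rot2` up
to sign and conjugation. -/
theorem lie_A3_sq_of_odd {D : f4} (h : dsigma 2 D = -D) : ⁅A3, ⁅A3, D⁆⁆ = D := by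
  obtain ⟨a, b, c, D₀, rfl, h0⟩ := exists_rot_decomposition D
  rw [map_add, map_add, map_add, dsigma_two_rot1, dsigma_two_rot2, dsigma_two_rot3,
    dsigma_eq_self (h0 2)] at h
  have h2 : rot3 c + D₀ = 0 := by
    have : (2 : ℝ) • (rot3 c + D₀) = 0 := by
      linear_combination (norm := module) h
    exact eq_zero_of_two_smul this
  rw [add_assoc, h2, add_zero, lie_add, lie_add, lie_A3_lie_A3_rot1, lie_A3_lie_A3_rot2]

/-- Evenness leaves `rot3 c` + D₀. This is a combination of `A3`, of some D₁ killed by N, of an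
imaginary `rot3`, where N² = 4, and of some N(`rot3 d`), where again N² = 4. -/
theorem lie_A3_cube_of_even {D : f4} (h : dsigma 2 D = D) :
    ⁅A3, ⁅A3, ⁅A3, D⁆⁆⁆ = (4 : ℝ) • ⁅A3, D⁆ := by
  obtain ⟨a, b, c, D₀, rfl, h0⟩ := exists_rot_decomposition D
  rw [map_add, map_add, map_add, dsigma_two_rot1, dsigma_two_rot2, dsigma_two_rot3,
    dsigma_eq_self (h0 2)] at h
  have h2 : rot1 a + rot2 b = 0 := by
    have : (2 : ℝ) • (rot1 a + rot2 b) = 0 := by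
      linear_combination (norm := module) -h
    exact eq_zero_of_two_smul this
  obtain ⟨d, D₁, hd, rfl, -, h1⟩ := exists_decomposition_of_apply_E h0
  rw [h2, zero_add, rot3_eq c]
  simp only [lie_add, lie_smul, lie_self, smul_zero, zero_add, h1, add_zero,
    lie_A3_lie_A3_rot3 hd, lie_A3_lie_A3_rot3 (dot_one_sub c), smul_add]

/-- Maximality of 𝔞 in the -1 eigenspace of θ, which consists of sums of `rot2` and `rot3`. There N²
is 1 on `rot2`, 4 on imaginary `rot3` and 0 on `A3`. -/
theorem mem_a_of_lie_A3 {P : f4} (hS : dsigma 0 P = -P) (hN : ⁅A3, P⁆ = 0) : P ∈ a := by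
  obtain ⟨a', b, c, D₀, hP, h0⟩ := exists_rot_decomposition P
  have h2 : rot1 a' + D₀ = 0 := by
    rw [hP, map_add, map_add, map_add, dsigma_zero_rot1, dsigma_zero_rot2, dsigma_zero_rot3,
      dsigma_eq_self (h0 0)] at hS
    refine eq_zero_of_two_smul ?_
    linear_combination (norm := module) hS
  have hP' : P = rot2 b + (dot 1 c • A3 + rot3 (c - dot 1 c • 1)) := by
    rw [hP, ← rot3_eq c]
    linear_combination (norm := module) h2
  have h3 : rot2 b + (4 : ℝ) • rot3 (c - dot 1 c • 1) = 0 := by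
    have h4 : ⁅A3, ⁅A3, P⁆⁆ = 0 := by rw [hN, lie_zero]
    rw [hP'] at h4
    simpa only [lie_add, lie_smul, lie_self, smul_zero, zero_add, lie_A3_lie_A3_rot2,
      lie_A3_lie_A3_rot3 (dot_one_sub c)] using h4
  -- The two terms of `h3` have opposite parity under dσ̃_2, so each of them vanishes.
  have h5 := congrArg (dsigma 2) h3
  rw [map_add, map_smul, dsigma_two_rot2, dsigma_two_rot3, dsigma_map_zero] at h5
  have h6 : P = dot 1 c • A3 := by
    rw [hP']
    clear hP hP' hN hS h2
    generalize rot3 (c - dot 1 c • 1) = r at *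
    generalize rot2 b = q at *
    have hq : q = 0 := by
      refine eq_zero_of_two_smul ?_
      linear_combination (norm := module) h3 - h5
    rw [hq, zero_add] at h3
    rw [hq, (smul_eq_zero.1 h3).resolve_left (by norm_num), zero_add, add_zero]
  rw [h6]
  exact Submodule.smul_mem _ _ (Submodule.mem_span_singleton_self _)

/-- As θ `A3` = -`A3`, both θ-eigencomponents of D commute with `A3`. -/
theorem mem_a_sup_m_of_lie_A3 {D : f4} (h : ⁅A3, D⁆ = 0) : D ∈ a ⊔ m := by
  have hD : D = (2⁻¹ : ℝ) • (D - dsigma 0 D) + (2⁻¹ : ℝ) • (D + dsigma 0 D) := by module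
  have hs : ⁅A3, dsigma 0 D⁆ = 0 := by
    have := congrArg (dsigma 0) h
    rw [LieEquiv.map_lie, dsigma_zero_A3, dsigma_map_zero, neg_lie, neg_eq_zero] at this
    exact this
  rw [hD]
  refine Submodule.add_mem_sup (mem_a_of_lie_A3 ?_ ?_) ⟨?_, ?_⟩
  · rw [map_smul, dsigma_map_sub, dsigma_dsigma]; module
  · rw [lie_smul, lie_sub, h, hs, sub_zero, smul_zero]
  · change dsigma 0 _ = _
    rw [map_smul, map_add, dsigma_dsigma, add_comm]
    rfl
  · rw [smul_lie, add_lie, ← lie_skew, h, ← lie_skew, hs]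
    simp

/-- The odd part of D is killed by N, yet N² = 1 on it. -/
theorem dsigma_two_eq_self_of_mem {D : f4} (h : D ∈ a ⊔ m) : dsigma 2 D = D := by
  have h1 : ⁅A3, D⁆ = 0 := by
    obtain ⟨x, hx, y, hy, rfl⟩ := Submodule.mem_sup.1 h
    obtain ⟨t, rfl⟩ := Submodule.mem_span_singleton.1 hx
    rw [lie_add, lie_smul, lie_self, smul_zero, zero_add, ← lie_skew, hy.2, neg_zero]
  have h2 : dsigma 2 (D - dsigma 2 D) = -(D - dsigma 2 D) := by
    rw [dsigma_map_sub, dsigma_dsigma]; abel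
  have h3 := lie_A3_sq_of_odd h2
  have h4 : ⁅A3, dsigma 2 D⁆ = 0 := by
    have := congrArg (dsigma 2) h1
    rwa [LieEquiv.map_lie, dsigma_A3_two, dsigma_map_zero] at this
  rw [lie_sub, h1, h4, sub_zero, lie_zero] at h3
  exact (sub_eq_zero.1 h3.symm).symm

/-! ### Roots, their parity, and the signature -/

/-- `Ã₃¹(1)` as an element of `𝔞`. -/
def A3a : a := ⟨A3, Submodule.mem_span_singleton_self _⟩

theorem exists_eq_smul_A3a (H : a) : ∃ t : ℝ, H = t • A3a := by
  obtain ⟨t, ht⟩ := Submodule.mem_span_singleton.1 H.2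
  exact ⟨t, Subtype.ext ht.symm⟩

theorem dual_eq_smul_alpha (l : Module.Dual ℝ a) : l = l A3a • alpha := by
  refine LinearMap.ext fun H => ?_
  obtain ⟨t, rfl⟩ := exists_eq_smul_A3a H
  have h : alpha A3a = 1 := alpha_A3
  rw [LinearMap.smul_apply, map_smul, map_smul, h, smul_eq_mul, smul_eq_mul, smul_eq_mul]
  ring

theorem mem_rootSpace_iff {l : Module.Dual ℝ a} {X : f4} :
    X ∈ rootSpace l ↔ ⁅A3, X⁆ = l A3a • X := by
  refine ⟨fun h => h A3a, fun h H => ?_⟩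
  obtain ⟨t, rfl⟩ := exists_eq_smul_A3a H
  rw [map_smul, smul_assoc, ← h]
  exact smul_lie t A3 X

theorem lie_A3_dsigma_two {X : f4} {v : ℝ} (h : ⁅A3, X⁆ = v • X) :
    ⁅A3, dsigma 2 X⁆ = v • dsigma 2 X := by
  have := congrArg (dsigma 2) h
  rwa [LieEquiv.map_lie, dsigma_A3_two, map_smul] at this

theorem dsigma_two_add_self (X : f4) : dsigma 2 (X + dsigma 2 X) = X + dsigma 2 X := by
  rw [map_add, dsigma_dsigma, add_comm]

theorem dsigma_two_sub_self (X : f4) : dsigma 2 (X - dsigma 2 X) = -(X - dsigma 2 X) := by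
  rw [dsigma_map_sub, dsigma_dsigma, neg_sub]

theorem odd_part_eq_zero {X : f4} {v : ℝ} (h : ⁅A3, X⁆ = v • X) (hv : v ^ 2 ≠ 1) :
    dsigma 2 X = X := by
  have h1 : ⁅A3, X - dsigma 2 X⁆ = v • (X - dsigma 2 X) := by
    rw [lie_sub, h, lie_A3_dsigma_two h, smul_sub]
  have h2 := lie_A3_sq_of_odd (dsigma_two_sub_self X)
  rw [h1, lie_smul, h1, smul_smul] at h2
  have h3 : (v * v - 1) • (X - dsigma 2 X) = 0 := by rw [sub_smul, h2, one_smul, sub_self]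
  have h4 := (smul_eq_zero.1 h3).resolve_left fun h => hv (by linarith)
  exact (sub_eq_zero.1 h4).symm

theorem even_part_eq_zero {X : f4} {v : ℝ} (h : ⁅A3, X⁆ = v • X) (h0 : v ≠ 0) (hv : v ^ 2 ≠ 4) :
    dsigma 2 X = -X := by
  have h1 : ⁅A3, X + dsigma 2 X⁆ = v • (X + dsigma 2 X) := by
    rw [lie_add, h, lie_A3_dsigma_two h, smul_add]
  have h2 := lie_A3_cube_of_even (dsigma_two_add_self X)
  rw [h1, lie_smul, h1, smul_smul, lie_smul, h1, smul_smul, smul_smul] at h2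
  have h3 : (v * v * v - 4 * v) • (X + dsigma 2 X) = 0 := by rw [sub_smul, h2, sub_self]
  have h4 := (smul_eq_zero.1 h3).resolve_left fun h =>
    hv (mul_left_cancel₀ h0 (by linarith))
  exact eq_neg_of_add_eq_zero_right h4

theorem root_cases (l : roots) :
    ((l : Module.Dual ℝ a) A3a ^ 2 = 1 ∧ ∀ X ∈ rootSpace l, dsigma 2 X = -X) ∨
    ((l : Module.Dual ℝ a) A3a ^ 2 = 4 ∧ ∀ X ∈ rootSpace l, dsigma 2 X = X) := by
  obtain ⟨l, hl0, hl⟩ := l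
  dsimp only
  have hv : l A3a ≠ 0 := fun h => hl0 (by rw [dual_eq_smul_alpha l, h, zero_smul])
  obtain ⟨X, hX, hX0⟩ := (Submodule.ne_bot_iff _).1 hl
  by_cases h1 : l A3a ^ 2 = 1
  · exact Or.inl ⟨h1, fun Y hY => even_part_eq_zero (mem_rootSpace_iff.1 hY) hv
      (by rw [h1]; norm_num)⟩
  · refine Or.inr ⟨?_, fun Y hY => odd_part_eq_zero (mem_rootSpace_iff.1 hY) h1⟩
    -- With both squares excluded, a nonzero root vector would be even and odd at once.
    by_contra h4
    have e1 := odd_part_eq_zero (mem_rootSpace_iff.1 hX) h1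
    have e2 := even_part_eq_zero (mem_rootSpace_iff.1 hX) hv h4
    rw [e1] at e2
    exact hX0 (eq_zero_of_two_smul (by rw [two_smul]; nth_rw 1 [e2]; exact neg_add_cancel X))

theorem eps_of_sq_eq_one {ε : roots → ℤˣ}
    (hε₁ : ∀ l : roots, (l : Module.Dual ℝ a) = alpha ∨
      (l : Module.Dual ℝ a) = -alpha → ε l = -1)
    {l : roots} (h : (l : Module.Dual ℝ a) A3a ^ 2 = 1) : ε l = -1 := by
  refine hε₁ l ?_
  rcases (sq_eq_sq_iff_eq_or_eq_neg.1 (h.trans (one_pow 2).symm)) with h | h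
  · left; rw [dual_eq_smul_alpha l, h, one_smul]
  · right; rw [dual_eq_smul_alpha l, h]; exact neg_one_smul ℝ alpha

theorem eps_of_sq_eq_four {ε : roots → ℤˣ}
    (hε₂ : ∀ l : roots, (l : Module.Dual ℝ a) = (2 : ℝ) • alpha ∨
      (l : Module.Dual ℝ a) = -((2 : ℝ) • alpha) → ε l = 1)
    {l : roots} (h : (l : Module.Dual ℝ a) A3a ^ 2 = 4) : ε l = 1 := by
  refine hε₂ l ?_
  rcases sq_eq_sq_iff_eq_or_eq_neg.1 (h.trans (by norm_num : (4 : ℝ) = 2 ^ 2)) with h | h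
  · left; rw [dual_eq_smul_alpha l, h]
  · right; rw [dual_eq_smul_alpha l, h]; exact neg_smul (2 : ℝ) alpha

/-- ε records the parity of the value at `A3`. Working with squares of values treats a root and its
negative together. -/
theorem isSignature_of_values {ε : roots → ℤˣ}
    (h1 : ∀ l : roots, (l : Module.Dual ℝ a) A3a ^ 2 = 1 → ε l = -1)
    (h4 : ∀ l : roots, (l : Module.Dual ℝ a) A3a ^ 2 = 4 → ε l = 1) : IsSignature ε := by
  have hc : ∀ l : roots, (l : Module.Dual ℝ a) A3a ^ 2 = 1 ∨
      (l : Module.Dual ℝ a) A3a ^ 2 = 4 := fun l => (root_cases l).imp And.left And.left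
  refine ⟨fun l l' h => ?_, fun l l' l'' h => ?_⟩
  · have hv : (l' : Module.Dual ℝ a) A3a = -(l : Module.Dual ℝ a) A3a := by
      rw [h, LinearMap.neg_apply]
    rcases hc l with hl | hl
    · rw [h1 l hl, h1 l' (by rw [hv, neg_sq, hl])]
    · rw [h4 l hl, h4 l' (by rw [hv, neg_sq, hl])]
  · have hv : (l'' : Module.Dual ℝ a) A3a =
        (l : Module.Dual ℝ a) A3a + (l' : Module.Dual ℝ a) A3a := by
      rw [h, LinearMap.add_apply]
    -- The three squares determine xy, and the value contradicts (xy)² = x²y².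
    have key : ∀ x y : ℝ, (x ^ 2 = 1 → y ^ 2 = 1 → (x + y) ^ 2 ≠ 1) ∧
        (x ^ 2 = 1 → y ^ 2 = 4 → (x + y) ^ 2 ≠ 4) ∧ (x ^ 2 = 4 → y ^ 2 = 4 → (x + y) ^ 2 ≠ 1) := by
      intro x y
      refine ⟨fun hx hy hs => ?_, fun hx hy hs => ?_, fun hx hy hs => ?_⟩
      · have : x * y = -1 / 2 := by linarith
        have : (x * y) ^ 2 = 1 := by rw [mul_pow, hx, hy]; norm_num
        simp_all; norm_num at this
      · have h : x * y = -1 / 2 := by linarith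
        have h' : (x * y) ^ 2 = 4 := by rw [mul_pow, hx, hy]; norm_num
        rw [h] at h'; norm_num at h'
      · have h : x * y = -7 / 2 := by linarith
        have h' : (x * y) ^ 2 = 16 := by rw [mul_pow, hx, hy]; norm_num
        rw [h] at h'; norm_num at h'
    have hs := hc l''
    rw [hv] at hs
    rcases hc l with hl | hl <;> rcases hc l' with hl' | hl'
    · rw [h1 l hl, h1 l' hl', h4 l'' (hv ▸ hs.resolve_left ((key _ _).1 hl hl'))]; rfl
    · rw [h1 l hl, h4 l' hl', h1 l'' (hv ▸ hs.resolve_right ((key _ _).2.1 hl hl'))]; rfl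
    · rw [add_comm] at hs hv
      rw [h4 l hl, h1 l' hl', h1 l'' (hv ▸ hs.resolve_right ((key _ _).2.1 hl' hl))]; rfl
    · rw [h4 l hl, h4 l' hl', h4 l'' (hv ▸ hs.resolve_left ((key _ _).2.2 hl hl'))]; rfl

theorem dsigma_map_neg (i : Fin 3) (D : f4) : dsigma i (-D) = -dsigma i D := by
  rw [← zero_sub, dsigma_map_sub, dsigma_map_zero, zero_sub]

/-! ### Existence and uniqueness of θ_ε -/

theorem isThetaEps_dsigma_one {ε : roots → ℤˣ}
    (h1 : ∀ l : roots, (l : Module.Dual ℝ a) A3a ^ 2 = 1 → ε l = -1)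
    (h4 : ∀ l : roots, (l : Module.Dual ℝ a) A3a ^ 2 = 4 → ε l = 1) :
    IsThetaEps ε (dsigma 1 : f4 →ₗ[ℝ] f4) := by
  refine ⟨fun l X hX => ?_, fun X hX => ?_⟩
  · change dsigma 1 X = _ • dsigma 0 X
    rw [dsigma_one_eq]
    rcases root_cases l with ⟨hv, h⟩ | ⟨hv, h⟩
    · rw [h1 l hv, h X hX, dsigma_map_neg]; simp
    · rw [h4 l hv, h X hX]; simp
  · change dsigma 1 X = dsigma 0 X
    rw [dsigma_one_eq, dsigma_two_eq_self_of_mem hX]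

/-- A nonzero eigenvector with eigenvalue v ≠ 0 itself shows that vα is a root, so no prior
knowledge of which roots occur is needed. -/
theorem IsThetaEps.eq_on_eigenvector {ε : roots → ℤˣ} {T T' : f4 →ₗ[ℝ] f4} (h : IsThetaEps ε T)
    (h' : IsThetaEps ε T') {v : ℝ} (hv : v ≠ 0) {X : f4} (hX : ⁅A3, X⁆ = v • X) : T X = T' X := by
  by_cases hX0 : X = 0
  · rw [hX0, map_zero, map_zero]
  have hval : (v • alpha) A3a = v := by
    have h : alpha A3a = 1 := alpha_A3
    rw [LinearMap.smul_apply, h, smul_eq_mul, mul_one]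
  have hm : X ∈ rootSpace (v • alpha) := by rwa [mem_rootSpace_iff, hval]
  have hr : v • alpha ∈ roots := by
    refine ⟨fun h0 => hv ?_, (Submodule.ne_bot_iff _).2 ⟨X, hm, hX0⟩⟩
    rw [← hval, h0, LinearMap.zero_apply]
  exact (h.1 ⟨_, hr⟩ X hm).trans (h'.1 ⟨_, hr⟩ X hm).symm

theorem IsThetaEps.unique {ε : roots → ℤˣ} {T T' : f4 →ₗ[ℝ] f4} (h : IsThetaEps ε T)
    (h' : IsThetaEps ε T') : T = T' := by
  have hk : ∀ X : f4, ⁅A3, X⁆ = 0 → T X = T' X := fun X hX =>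
    (h.2 X (mem_a_sup_m_of_lie_A3 hX)).trans (h'.2 X (mem_a_sup_m_of_lie_A3 hX)).symm
  have hodd : ∀ Y : f4, ⁅A3, ⁅A3, Y⁆⁆ = Y → T Y = T' Y := by
    intro Y hY
    -- From N²Y = Y, the vectors Y ± NY are eigenvectors for ±1.
    have e1 := h.eq_on_eigenvector h' (v := 1) (X := Y + ⁅A3, Y⁆) one_ne_zero (by
      rw [lie_add, hY]; module)
    have e2 := h.eq_on_eigenvector h' (v := -1) (X := Y - ⁅A3, Y⁆) (by norm_num) (by
      rw [lie_sub, hY]; module)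
    have : Y = (2⁻¹ : ℝ) • (Y + ⁅A3, Y⁆) + (2⁻¹ : ℝ) • (Y - ⁅A3, Y⁆) := by module
    rw [this, map_add, map_add, map_smul, map_smul, map_smul, map_smul, e1, e2]
  have heven : ∀ Z : f4, ⁅A3, ⁅A3, ⁅A3, Z⁆⁆⁆ = (4 : ℝ) • ⁅A3, Z⁆ → T Z = T' Z := by
    intro Z hZ
    -- From N³Z = 4NZ, the vectors N²Z ± 2NZ are eigenvectors for ±2, and Z - N²Z/4 lies in the
    -- kernel.
    have e1 := h.eq_on_eigenvector h' (v := 2) (X := ⁅A3, ⁅A3, Z⁆⁆ + (2 : ℝ) • ⁅A3, Z⁆)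
      two_ne_zero (by rw [lie_add, hZ, lie_smul]; module)
    have e2 := h.eq_on_eigenvector h' (v := -2) (X := ⁅A3, ⁅A3, Z⁆⁆ - (2 : ℝ) • ⁅A3, Z⁆)
      (by norm_num) (by rw [lie_sub, hZ, lie_smul]; module)
    have e3 := hk (Z - (4⁻¹ : ℝ) • ⁅A3, ⁅A3, Z⁆⁆) (by rw [lie_sub, lie_smul, hZ]; module)
    have : Z = (Z - (4⁻¹ : ℝ) • ⁅A3, ⁅A3, Z⁆⁆) +
        ((8⁻¹ : ℝ) • (⁅A3, ⁅A3, Z⁆⁆ + (2 : ℝ) • ⁅A3, Z⁆) +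
        (8⁻¹ : ℝ) • (⁅A3, ⁅A3, Z⁆⁆ - (2 : ℝ) • ⁅A3, Z⁆)) := by module
    rw [this, map_add, map_add, e3, map_add, map_add, map_smul, map_smul, map_smul, map_smul,
      e1, e2]
  refine LinearMap.ext fun D => ?_
  have : D = (2⁻¹ : ℝ) • (D + dsigma 2 D) + (2⁻¹ : ℝ) • (D - dsigma 2 D) := by module
  rw [this, map_add, map_add, map_smul, map_smul, map_smul, map_smul,
    heven _ (lie_A3_cube_of_even (dsigma_two_add_self D)),
    hodd _ (lie_A3_sq_of_odd (dsigma_two_sub_self D))]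

/-! ### Fixed groups of the involutions as stabilizers -/

theorem dot_self_nonneg (x : Octonion ℝ) : 0 ≤ dot x x := by
  rw [dot_eq]
  simp only [← sq]
  positivity

theorem eq_zero_of_dot_self {x : Octonion ℝ} (h : dot x x = 0) : x = 0 := by
  rw [dot_eq] at h
  simp only [← sq] at h
  apply Octonion.ext <;> apply Quaternion.ext <;>
    refine sq_eq_zero_iff.1 (le_antisymm ?_ (sq_nonneg _))
  all_goals
    linarith [sq_nonneg x.fst.re, sq_nonneg x.fst.imI, sq_nonneg x.fst.imJ, sq_nonneg x.fst.imK,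
      sq_nonneg x.snd.re, sq_nonneg x.snd.imI, sq_nonneg x.snd.imJ, sq_nonneg x.snd.imK]

theorem eq_zero_of_neg_eq {x : Octonion ℝ} (h : -x = x) : x = 0 := by
  linear_combination (norm := module) (-2⁻¹ : ℝ) • h

theorem exists_unit_smul (y : Octonion ℝ) : ∃ (r : ℝ) (u : Octonion ℝ),
    dot u u = 1 ∧ y = r • u ∧ (dot 1 y = 0 → dot 1 u = 0) := by
  by_cases hy : y = 0
  -- For y = 0 the unit must still be orthogonal to 1.
  · exact ⟨0, mk 0 1, by simp [dot_eq], by rw [hy, zero_smul], fun _ => by simp [dot_eq]⟩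
  · have h0 : 0 < dot y y :=
      lt_of_le_of_ne (dot_self_nonneg y) fun h => hy (eq_zero_of_dot_self h.symm)
    have hs : Real.sqrt (dot y y) ≠ 0 := (Real.sqrt_pos.2 h0).ne'
    refine ⟨Real.sqrt (dot y y), (Real.sqrt (dot y y))⁻¹ • y, ?_, ?_, fun h => ?_⟩
    · rw [dot_smul_left, dot_smul_right, ← mul_assoc, ← mul_inv, Real.mul_self_sqrt h0.le,
        inv_mul_cancel₀ h0.ne']
    · rw [smul_smul, mul_inv_cancel₀ hs, one_smul]
    · rw [dot_smul_right, h, mul_zero]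

theorem F4_map_jordanFun (g : F4) (X Y : J1) :
    g.1 (jordanFun X Y) = jordanFun (g.1 X) (g.1 Y) := g.2 X Y

theorem F4_mul_apply (g h : F4) (X : J1) : (g * h).1 X = g.1 (h.1 X) := rfl

theorem F4_apply_inv_apply (g : F4) (X : J1) : g.1 ((g⁻¹ : F4).1 X) = X :=
  g.1.apply_symm_apply X

theorem F4_apply_one (g : F4) : g.1 (E 0 + E 1 + E 2) = E 0 + E 1 + E 2 := by
  have h := F4_map_jordanFun g (E 0 + E 1 + E 2) ((g⁻¹ : F4).1 (E 0 + E 1 + E 2))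
  rwa [jordanFun_one, F4_apply_inv_apply, jordanFun_comm, jordanFun_one, eq_comm] at h

theorem E_ne_zero (i : Fin 3) : E i ≠ 0 := fun h => by
  have := congrArg (fun X : J1 => X.1 i) h
  simp [E] at this

theorem F4_apply_ne_zero (g : F4) {X : J1} (h : X ≠ 0) : g.1 X ≠ 0 := fun h' =>
  h (by simpa using h')

theorem F4_apply_E_idem (g : F4) (i : Fin 3) : jordanFun (g.1 (E i)) (g.1 (E i)) = g.1 (E i) := by
  rw [← F4_map_jordanFun, jordanFun_E_self]

theorem jordanFun_E_of_sigma {i : Fin 3} {X : J1} (h : (sigma i).1 X = X) :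
    jordanFun (E i) X = X.1 i • E i := by
  have h' : ∀ j, j ≠ i → X.2 j = 0 := fun j hj => by
    have := congrArg (fun X : J1 => X.2 j) h
    simp only [sigma_apply, if_neg hj] at this
    exact eq_zero_of_neg_eq this
  fin_cases i
  · simp only [Fin.zero_eta, jordanFun_E_zero, h' 1 (by decide), h' 2 (by decide)]
    apply J1_ext <;> simp [E]
  · simp only [Fin.mk_one, jordanFun_E_one, h' 0 (by decide), h' 2 (by decide)]
    apply J1_ext <;> simp [E]
  · simp only [Fin.reduceFinMk, jordanFun_E_two, h' 1 (by decide), h' 0 (by decide)]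
    apply J1_ext <;> simp [E]

/-- On σ_i-fixed vectors, L_{E_i} has its image in the line of E_i. An automorphism commuting with
σ_i transports this property to g E_i. -/
theorem exists_jordanFun_eq_smul {i : Fin 3} {g : F4}
    (h : ∀ X, (sigma i).1 (g.1 X) = g.1 ((sigma i).1 X)) {Y : J1} (hY : (sigma i).1 Y = Y) :
    ∃ c : ℝ, jordanFun (g.1 (E i)) Y = c • g.1 (E i) := by
  have hW : (sigma i).1 ((g⁻¹ : F4).1 Y) = (g⁻¹ : F4).1 Y := by
    apply g.1.injective
    rw [← h]
    rw [F4_apply_inv_apply, hY]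
  refine ⟨((g⁻¹ : F4).1 Y).1 i, ?_⟩
  conv_lhs => rw [← F4_apply_inv_apply g Y, ← F4_map_jordanFun, jordanFun_E_of_sigma hW, map_smul]

theorem sigma_E (i j : Fin 3) : (sigma i).1 (E j) = E j := by
  rw [sigma_apply]
  refine Prod.ext rfl (funext fun l => ?_)
  simp [E_snd]

theorem sigma_F (i : Fin 3) (x : Octonion ℝ) : (sigma i).1 (F i x) = F i x := by
  rw [sigma_apply]
  refine Prod.ext rfl (funext fun l => ?_)
  by_cases h : l = i <;> simp [F, h]

/-- Here p, q, r, y are the coordinates of a σ_i-fixed idempotent, p being the i-th, and s is the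
sign of (x_i|x_i) in the product. `b1`, `b3` come from multiplying by another E_j, `d` from
multiplying by F_i(1). If y ≠ 0, then c' = 1/2, hence q = 0 and `i1` forces y = 0. If y = 0, then q
+ r = 0 and q, r are idempotent. -/
theorem idempotent_cases {p q r c' c'' s : ℝ} {y : Octonion ℝ} (hs : s ≠ 0)
    (b1 : q = c' * q) (b3 : (2⁻¹ : ℝ) • y = c' • y) (i0 : p * p = p)
    (i1 : q * q + s * dot y y = q) (i2 : r * r + s * dot y y = r)
    (d : 2⁻¹ * (q + r) = c'' * y.fst.re) :
    (p = 1 ∧ q = 0 ∧ r = 0 ∧ y = 0) ∨ (p = 0 ∧ q = 0 ∧ r = 0 ∧ y = 0) := by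
  have hp : p = 1 ∨ p = 0 := by
    rcases eq_or_ne p 0 with h | h
    · exact Or.inr h
    · exact Or.inl (mul_left_cancel₀ h (by rw [i0, mul_one]))
  have h : q = 0 ∧ r = 0 ∧ y = 0 := by
    by_cases hy : y = 0
    · subst hy
      simp only [dot_zero_left, mul_zero, add_zero, fst_zero, Quaternion.re_zero] at i1 i2 d
      have : q * q + r * r = 0 := by linarith
      exact ⟨by nlinarith [mul_self_nonneg q, mul_self_nonneg r],
        by nlinarith [mul_self_nonneg q, mul_self_nonneg r], rfl⟩
    · exfalso
      have hc' : c' = 2⁻¹ := by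
        have : (2⁻¹ - c') • y = 0 := by rw [sub_smul, b3, sub_self]
        linarith [(smul_eq_zero.1 this).resolve_right hy]
      have hq : q = 0 := by rw [hc'] at b1; linarith
      rw [hq] at i1
      have : s * dot y y = 0 := by linarith
      exact hy (eq_zero_of_dot_self ((mul_eq_zero.1 this).resolve_left hs))
  exact hp.imp (fun e => ⟨e, h⟩) (fun e => ⟨e, h⟩)

theorem apply_E_zero_of_sigma_comm {g : F4}
    (h : ∀ X, (sigma 0).1 (g.1 X) = g.1 ((sigma 0).1 X)) : g.1 (E 0) = E 0 := by
  have he0 := F4_apply_ne_zero g (E_ne_zero 0)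
  have hi := F4_apply_E_idem g 0
  have hs := h (E 0)
  obtain ⟨c', hc'⟩ := exists_jordanFun_eq_smul h (sigma_E 0 1)
  obtain ⟨c'', hc''⟩ := exists_jordanFun_eq_smul h (sigma_F 0 1)
  rw [sigma_E] at hs
  generalize g.1 (E 0) = e at *
  have s1 : e.2 1 = 0 := by
    have := congrArg (fun X : J1 => X.2 1) hs
    exact eq_zero_of_neg_eq (by simpa [sigma_apply] using this)
  have s2 : e.2 2 = 0 := by
    have := congrArg (fun X : J1 => X.2 2) hs
    exact eq_zero_of_neg_eq (by simpa [sigma_apply] using this)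
  rw [jordanFun_comm, jordanFun_E_one] at hc'
  have i0 := congrArg (fun X : J1 => X.1 0) hi
  have i1 := congrArg (fun X : J1 => X.1 1) hi
  have i2 := congrArg (fun X : J1 => X.1 2) hi
  have b1 := congrArg (fun X : J1 => X.1 1) hc'
  have b3 := congrArg (fun X : J1 => X.2 0) hc'
  have d3 := congrArg (fun X : J1 => (X.2 0).fst.re) hc''
  simp [jordanFun, s1, s2, dot_zero_left, F] at i0 i1 i2 b1 b3 d3
  rcases idempotent_cases (s := 1) one_ne_zero b1 b3 i0
    (by linarith) (by linarith) d3 with ⟨h0, h1, h2, h3⟩ | ⟨h0, h1, h2, h3⟩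
  · apply J1_ext <;> simp [E, h0, h1, h2, h3, s1, s2]
  · exact absurd (by apply J1_ext <;> simp [h0, h1, h2, h3, s1, s2]) he0

theorem apply_E_one_of_sigma_comm {g : F4}
    (h : ∀ X, (sigma 1).1 (g.1 X) = g.1 ((sigma 1).1 X)) : g.1 (E 1) = E 1 := by
  have he0 := F4_apply_ne_zero g (E_ne_zero 1)
  have hi := F4_apply_E_idem g 1
  have hs := h (E 1)
  obtain ⟨c', hc'⟩ := exists_jordanFun_eq_smul h (sigma_E 1 0)
  obtain ⟨c'', hc''⟩ := exists_jordanFun_eq_smul h (sigma_F 1 1)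
  rw [sigma_E] at hs
  generalize g.1 (E 1) = e at *
  have s0 : e.2 0 = 0 := by
    have := congrArg (fun X : J1 => X.2 0) hs
    exact eq_zero_of_neg_eq (by simpa [sigma_apply] using this)
  have s2 : e.2 2 = 0 := by
    have := congrArg (fun X : J1 => X.2 2) hs
    exact eq_zero_of_neg_eq (by simpa [sigma_apply] using this)
  rw [jordanFun_comm, jordanFun_E_zero] at hc'
  have i0 := congrArg (fun X : J1 => X.1 0) hi
  have i1 := congrArg (fun X : J1 => X.1 1) hi
  have i2 := congrArg (fun X : J1 => X.1 2) hi
  have b0 := congrArg (fun X : J1 => X.1 0) hc'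
  have b3 := congrArg (fun X : J1 => X.2 1) hc'
  have d3 := congrArg (fun X : J1 => (X.2 1).fst.re) hc''
  simp [jordanFun, s0, s2, dot_zero_left, F] at i0 i1 i2 b0 b3 d3
  rcases idempotent_cases (s := -1) (r := e.1 2) (by norm_num) b0 b3 i1
    (by linarith) (by linarith) (by rw [add_comm]; exact d3) with ⟨h1, h0, h2, h3⟩ | ⟨h1, h0, h2, h3⟩
  · apply J1_ext <;> simp [E, h0, h1, h2, h3, s0, s2]
  · exact absurd (by apply J1_ext <;> simp [h0, h1, h2, h3, s0, s2]) he0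

theorem mem_fixedSubgroup_zero_iff {g : F4} :
    g ∈ fixedSubgroup (sigmaTilde 0) ↔ g.1 (E 0) = E 0 :=
  mem_fixedSubgroup_iff.trans ⟨apply_E_zero_of_sigma_comm, sigma_comm_of_apply_E⟩

theorem mem_fixedSubgroup_one_iff {g : F4} :
    g ∈ fixedSubgroup (sigmaTilde 1) ↔ g.1 (E 1) = E 1 :=
  mem_fixedSubgroup_iff.trans ⟨apply_E_one_of_sigma_comm, sigma_comm_of_apply_E⟩

/-! ### One-parameter subgroups -/

/-- An integral curve of a derivation is given by its exponentials. -/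
theorem exp_smul_apply_of_hasDerivAt {D : f4} {c : ℝ → J1}
    (h : ∀ t, HasDerivAt c (D.1 (c t)) t) (t : ℝ) : (exp (t • D)).1 (c 0) = c t := by
  -- Uniqueness of the integral curve: pulled back along the flow, the curve is constant.
  have hd : ∀ s : ℝ, HasDerivAt (fun s : ℝ => NormedSpace.exp (s • (-D.1)) (c s)) 0 s := by
    intro s
    refine ((hasDerivAt_exp_smul_const (𝕂 := ℝ) (-D.1) s).clm_apply (h s)).congr_deriv ?_
    simp
  have hconst := is_const_of_deriv_eq_zero (fun s => (hd s).differentiableAt)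
    (fun s => (hd s).deriv) t 0
  simp only [zero_smul, NormedSpace.exp_zero, one_apply_eq_self] at hconst
  have hinv : NormedSpace.exp (t • D.1) * NormedSpace.exp (t • (-D.1)) = 1 := by
    let _ := normedAlgebraRat
    rw [smul_neg, ← NormedSpace.exp_add_of_commute (Commute.refl (t • D.1)).neg_right,
      add_neg_cancel, NormedSpace.exp_zero]
  have h5 := congrArg (fun T : J1 →L[ℝ] J1 => T (c t)) hinv
  change NormedSpace.exp (t • D.1) (c 0) = c t
  rw [← hconst]
  exact h5

theorem exp_apply_of_apply_eq_zero {D : f4} {X : J1} (h : D.1 X = 0) (t : ℝ) :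
    (exp (t • D)).1 X = X :=
  exp_smul_apply_of_hasDerivAt (c := fun _ => X) (fun s => by
    rw [h]; exact hasDerivAt_const s X) t

theorem rot2_apply_E_one (u : Octonion ℝ) : (rot2 u).1 (E 1) = 0 := by
  rw [rot2_apply]
  apply J1_ext <;> simp [rot2Fun, E, dot_zero_right]

/-- The one-parameter group of `rot2 u` acts by hyperbolic rotations. -/
theorem exp_rot2_apply {u : Octonion ℝ} (hu : dot u u = 1) (p A B t : ℝ) :
    (exp (t • rot2 u)).1 (p • (E 0 + E 2) + A • (E 0 - E 2) + B • F 1 u) =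
      p • (E 0 + E 2) + (A * Real.cosh (2 * t) + B * Real.sinh (2 * t)) • (E 0 - E 2) +
      (A * Real.sinh (2 * t) + B * Real.cosh (2 * t)) • F 1 u := by
  have h := exp_smul_apply_of_hasDerivAt (D := rot2 u) (c := fun t => p • (E 0 + E 2) +
    (A * Real.cosh (2 * t) + B * Real.sinh (2 * t)) • (E 0 - E 2) +
      (A * Real.sinh (2 * t) + B * Real.cosh (2 * t)) • F 1 u) (fun t => by
    have h2 : HasDerivAt (fun t : ℝ => 2 * t) 2 t := by
      simpa using (hasDerivAt_id t).const_mul 2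
    have hc := h2.cosh
    have hs := h2.sinh
    have := (((hc.const_mul A).add (hs.const_mul B)).smul_const (E 0 - E 2)).const_add
      (p • (E 0 + E 2)) |>.add (((hs.const_mul A).add (hc.const_mul B)).smul_const (F 1 u))
    refine this.congr_deriv ?_
    have e1 : (rot2 u).1 (E 0 + E 2) = 0 := by
      rw [rot2_apply]
      apply J1_ext <;> simp [rot2Fun, E, dot_zero_right]
    have e2 : (rot2 u).1 (E 0 - E 2) = (2 : ℝ) • F 1 u := by
      rw [rot2_apply]
      apply J1_ext <;> simp [rot2Fun, E, F, dot_zero_right]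
      module
    have e3 : (rot2 u).1 (F 1 u) = (2 : ℝ) • (E 0 - E 2) := by
      rw [rot2_apply]
      apply J1_ext <;> simp [rot2Fun, E, F, hu]
    simp only [map_add, map_smul, e1, e2, e3]
    module) t
  simpa using h

/-- The one-parameter group of `[A₃(1), A₃(d)]` acts by rotations in the plane of `1` and `d`. -/
theorem exp_lie_A3_rot3_apply {d : Octonion ℝ} (hd : dot 1 d = 0) (hdd : dot d d = 1) (φ t : ℝ) :
    (exp (t • ⁅A3, rot3 d⁆)).1 (Real.cos φ • F 2 1 + Real.sin φ • F 2 d) =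
      Real.cos (φ - 4 * t) • F 2 1 + Real.sin (φ - 4 * t) • F 2 d := by
  have h := exp_smul_apply_of_hasDerivAt (D := ⁅A3, rot3 d⁆)
    (c := fun t => Real.cos (φ - 4 * t) • F 2 1 + Real.sin (φ - 4 * t) • F 2 d) (fun t => by
    have h2 : HasDerivAt (fun t : ℝ => φ - 4 * t) (-4) t := by
      simpa using ((hasDerivAt_id t).const_mul 4).const_sub φ
    refine ((h2.cos.smul_const (F 2 1)).add (h2.sin.smul_const (F 2 d))).congr_deriv ?_
    have e1 : (⁅A3, rot3 d⁆ : f4).1 (F 2 1) = (-4 : ℝ) • F 2 d := by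
      rw [lie_A3_rot3_F hd, dot_comm d 1, hd, dot_one_one]
      apply J1_ext <;> simp [F]
    have e2 : (⁅A3, rot3 d⁆ : f4).1 (F 2 d) = (4 : ℝ) • F 2 1 := by
      rw [lie_A3_rot3_F hd, hd, hdd]
      apply J1_ext <;> simp [F]
    simp only [map_add, map_smul, e1, e2]
    module) t
  simpa using h

/-- The indefinite signs separate the two idempotents. The Peirce space of E_2 for 1/2 contains the
nonzero F_0(1) with idempotent square E_1 + E_2. In that of E_0, every square has ξ-coordinate 0
equal to minus a sum of norms. -/
theorem F4_apply_E_zero_ne_E_two (g : F4) : g.1 (E 0) ≠ E 2 := by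
  intro h
  obtain ⟨X, hX⟩ : ∃ X, g.1 X = F 0 1 := ⟨_, F4_apply_inv_apply g _⟩
  have hX0 : F 0 (1 : Octonion ℝ) ≠ 0 := fun h0 => by
    have := congrArg (fun X : J1 => (X.2 0).fst.re) h0
    simp [F] at this
  have h1 : jordanFun (E 0) X = (2⁻¹ : ℝ) • X := by
    apply g.1.injective
    rw [F4_map_jordanFun, h, hX, map_smul, hX, jordanFun_E_two]
    apply J1_ext <;> simp [F]
  have h2 : jordanFun (jordanFun X X) (jordanFun X X) = jordanFun X X := by
    apply g.1.injective
    simp only [F4_map_jordanFun, hX]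
    have : jordanFun (F 0 (1 : Octonion ℝ)) (F 0 1) = E 1 + E 2 := by
      apply J1_ext <;> simp [jordanFun, F, E, dot_zero_left, dot_one_one]
    rw [this]
    apply J1_ext <;> simp [jordanFun, E, dot_zero_left]
  rw [jordanFun_E_zero] at h1
  have a0 := congrArg (fun X : J1 => X.1 0) h1
  have a1 := congrArg (fun X : J1 => X.1 1) h1
  have a2 := congrArg (fun X : J1 => X.1 2) h1
  have b0 := (congrArg (fun X : J1 => X.2 0) h1).symm
  simp at a0 a1 a2 b0
  have a0' : X.1 0 = 0 := by linarith
  have p0 : (jordanFun X X).1 0 = -(dot (X.2 1) (X.2 1) + dot (X.2 2) (X.2 2)) := by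
    rw [jordanFun_fst_zero, a0']; ring
  have p1 : (jordanFun X X).2 1 = 0 := by
    rw [jordanFun_snd_one, a0', a2, b0]; simp
  have p2 : (jordanFun X X).2 2 = 0 := by
    rw [jordanFun_snd_two, a0', a1, b0]; simp
  have h3 := congrArg (fun X : J1 => X.1 0) h2
  rw [jordanFun_fst_zero, p1, p2, dot_zero_left, p0] at h3
  have n1 := dot_self_nonneg (X.2 1)
  have n2 := dot_self_nonneg (X.2 2)
  -- With n the sum of norms, idempotency of the square reads n² = -n with n ≥ 0.
  have hs : dot (X.2 1) (X.2 1) + dot (X.2 2) (X.2 2) = 0 := by nlinarith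
  have z1 := eq_zero_of_dot_self (x := X.2 1) (by linarith)
  have z2 := eq_zero_of_dot_self (x := X.2 2) (by linarith)
  have hz : X = 0 := by apply J1_ext <;> simp [a0', a1, a2, b0, z1, z2]
  rw [hz, map_zero] at hX
  exact hX0 hX.symm

/-! ### The factorization of the stabilizer of E_1 -/

/-- The subgroup generated by the exponentials of the fixed points of `dσ̃₂`. -/
def expSubgroup : Subgroup F4 := Subgroup.closure (exp '' {D : f4 | dsigma 1 D = D})

theorem exp_mem_expSubgroup {D : f4} (h : D.1 (E 1) = 0) (t : ℝ) :
    exp (t • D) ∈ expSubgroup :=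
  Subgroup.subset_closure ⟨t • D, by
    change dsigma 1 _ = _
    rw [map_smul, dsigma_eq_self h], rfl⟩

theorem expSubgroup_le : expSubgroup ≤ fixedSubgroup (sigmaTilde 1) := by
  refine (Subgroup.closure_le _).2 ?_
  rintro _ ⟨D, hD, rfl⟩
  refine mem_fixedSubgroup_iff.2 fun X => ?_
  have hc : Commute (((sigma 1).1 : J1 ≃L[ℝ] J1) : J1 →L[ℝ] J1) D.1 :=
    ContinuousLinearMap.ext (dsigma_eq_iff.1 hD)
  exact congrArg (fun T : J1 →L[ℝ] J1 => T X) hc.exp_right.eq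

/-- Such g fixes E_0 and commutes with `A3`, and E_1 is E_0 minus half of `A3`² E_0. -/
theorem M_apply {g : F4} (hg : g ∈ M) : g.1 (E 1) = E 1 := by
  have h0 := mem_fixedSubgroup_zero_iff.1 hg.1
  have hc : ∀ X, g.1 (A3Fun X) = A3Fun (g.1 X) := by
    intro X
    have := congrArg (fun D : f4 => D.1 (g.1 X)) hg.2
    simpa [Ad_apply, A3_apply] using this
  have e1 : E 1 = E 0 + (2⁻¹ : ℝ) • A3Fun (A3Fun (E 1)) := by
    apply J1_ext <;> simp [A3Fun, E_fst, E_snd, dot_zero_right, dot_neg_right, dot_one_one]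
  have e2 : A3Fun (A3Fun (E 1)) = - A3Fun (A3Fun (E 0)) := by
    apply J1_ext <;> simp [A3Fun, E_fst, E_snd, dot_zero_right, dot_neg_right, dot_one_one]
  rw [e1, e2, map_add, map_smul, map_neg, hc, hc, h0]

theorem mem_M_of_apply {g : F4} (h0 : g.1 (E 0) = E 0) (h1 : g.1 (F 2 1) = F 2 1) : g ∈ M :=
  ⟨mem_fixedSubgroup_zero_iff.2 h0, Ad_A3_eq h0 h1⟩

/-- The image of E_0 is an idempotent in the Peirce-0 space of E_1, a spin factor spanned by E_0,
E_2 and F_1. Its idempotents other than 0 and the unit have trace 1 and form a hyperboloid of two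
sheets. -/
theorem stab_apply_E_zero {g : F4} (h : g.1 (E 1) = E 1) :
    ∃ (w r : ℝ) (u : Octonion ℝ), dot u u = 1 ∧ w ^ 2 - r ^ 2 = 4⁻¹ ∧
      g.1 (E 0) = (2⁻¹ : ℝ) • (E 0 + E 2) + w • (E 0 - E 2) + r • F 1 u := by
  have hi := F4_apply_E_idem g 0
  have h1 : jordanFun (E 1) (g.1 (E 0)) = 0 := by
    rw [← F4_jordanFun_of_apply_eq h]
    have : jordanFun (E 1) (E 0) = 0 := by
      rw [jordanFun_E_one]; apply J1_ext <;> simp [E]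
    rw [this, map_zero]
  have hn0 := F4_apply_ne_zero g (E_ne_zero 0)
  have hn2 := F4_apply_ne_zero g (E_ne_zero 2)
  -- That g E_2 is nonzero will exclude the unit E_0 + E_2 as the image of E_0.
  have hs : g.1 (E 2) = E 0 + E 2 - g.1 (E 0) := by
    have := F4_apply_one g
    rw [map_add, map_add, h] at this
    linear_combination (norm := module) this
  rw [hs] at hn2
  clear hs
  generalize g.1 (E 0) = e at *
  rw [jordanFun_E_one] at h1
  have a1 := congrArg (fun X : J1 => X.1 1) h1
  have b0 := congrArg (fun X : J1 => X.2 0) h1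
  have b2 := congrArg (fun X : J1 => X.2 2) h1
  have i0 := congrArg (fun X : J1 => X.1 0) hi
  have i2 := congrArg (fun X : J1 => X.1 2) hi
  have i3 := congrArg (fun X : J1 => X.2 1) hi
  simp at a1 b0 b2
  simp only [jordanFun_fst_zero, jordanFun_fst_two, jordanFun_snd_one, b0, b2, dot_zero_left,
    mul_zero, zero_mul, map_zero, add_zero, sub_zero] at i0 i2 i3
  obtain ⟨r, u, hu, hy, -⟩ := exists_unit_smul (e.2 1)
  have hr : dot (e.2 1) (e.2 1) = r ^ 2 := by
    rw [hy, dot_smul_left, dot_smul_right, hu]; ring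
  rw [hr] at i0 i2
  have hsum : e.1 0 + e.1 2 = 1 := by
    by_cases hy0 : e.2 1 = 0
    · have hr0 : r ^ 2 = 0 := by rw [← hr, hy0, dot_zero_left]
      rw [hr0] at i0 i2
      have c0 : e.1 0 = 0 ∨ e.1 0 = 1 := by
        have : e.1 0 * (e.1 0 - 1) = 0 := by linarith
        exact (mul_eq_zero.1 this).imp id sub_eq_zero.1
      have c2 : e.1 2 = 0 ∨ e.1 2 = 1 := by
        have : e.1 2 * (e.1 2 - 1) = 0 := by linarith
        exact (mul_eq_zero.1 this).imp id sub_eq_zero.1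
      rcases c0 with c0 | c0 <;> rcases c2 with c2 | c2
      · exact absurd (by apply J1_ext <;> simp [c0, c2, a1, b0, b2, hy0]) hn0
      · rw [c0, c2, zero_add]
      · rw [c0, c2, add_zero]
      · exact absurd (by apply J1_ext <;> simp [c0, c2, a1, b0, b2, hy0, E]) hn2
    · have : (e.1 2 + e.1 0 - 1) • e.2 1 = 0 := by
        linear_combination (norm := module) i3
      linarith [(smul_eq_zero.1 this).resolve_right hy0]
  refine ⟨e.1 0 - 2⁻¹, r, u, hu, by linarith, ?_⟩
  have h2 : e.1 2 = 1 - e.1 0 := by linarith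
  apply J1_ext <;> simp [E, F, a1, b0, b2, hy, h2]
  ring

theorem exists_expSubgroup_apply_E_zero {g : F4} (h : g.1 (E 1) = E 1) :
    ∃ k ∈ expSubgroup, (k * g).1 (E 0) = E 0 ∧ (k * g).1 (E 1) = E 1 := by
  obtain ⟨w, r, u, hu, hw, he⟩ := stab_apply_E_zero h
  have hfix : ∀ t : ℝ, (exp (t • rot2 u) * g).1 (E 1) = E 1 := fun t => by
    rw [F4_mul_apply, h, exp_apply_of_apply_eq_zero (rot2_apply_E_one u)]
  have hx : ∀ t : ℝ, (exp (t • rot2 u) * g).1 (E 0) = _ := fun t =>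
    (congrArg _ he).trans (exp_rot2_apply hu 2⁻¹ w r t)
  have hcs := Real.cosh_sq (Real.arsinh (2 * r))
  rw [Real.sinh_arsinh] at hcs
  -- The point (2w, 2r) is (± cosh s, sinh s) with s = arsinh(2r). The flow moves it by the
  -- hyperbolic angle 2t, so t = ∓ s/2 takes it to the vertex of its branch.
  have hw2 : (2 * w) ^ 2 = Real.cosh (Real.arsinh (2 * r)) ^ 2 := by linarith
  rcases sq_eq_sq_iff_eq_or_eq_neg.1 hw2 with h2 | h2
  · refine ⟨_, exp_mem_expSubgroup (rot2_apply_E_one u) (-(Real.arsinh (2 * r)) / 2), ?_, hfix _⟩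
    rw [hx, mul_div_cancel₀ _ two_ne_zero, Real.cosh_neg, Real.sinh_neg, Real.sinh_arsinh, ← h2]
    have e1 : w * (2 * w) + r * -(2 * r) = 2⁻¹ := by linarith
    have e2 : w * -(2 * r) + r * (2 * w) = 0 := by ring
    rw [e1, e2]
    module
  -- The vertex of the negative branch is E_2.
  · exfalso
    refine F4_apply_E_zero_ne_E_two (exp ((Real.arsinh (2 * r) / 2) • rot2 u) * g) ?_
    have h3 : Real.cosh (Real.arsinh (2 * r)) = -(2 * w) := by linarith
    rw [hx, mul_div_cancel₀ _ two_ne_zero, Real.sinh_arsinh, h3]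
    have e1 : w * -(2 * w) + r * (2 * r) = -2⁻¹ := by linarith
    have e2 : w * (2 * r) + r * -(2 * w) = 0 := by ring
    rw [e1, e2]
    module

/-- Such g maps F_2(1) to some F_2(c) with c a unit octonion, and a rotation in a plane through 1
and c carries c back to 1. -/
theorem exists_expSubgroup_mul_mem_M {g : F4} (h0 : g.1 (E 0) = E 0) (h1 : g.1 (E 1) = E 1) :
    ∃ k ∈ expSubgroup, k * g ∈ M := by
  obtain ⟨c, hc, hcc⟩ : ∃ c, g.1 (F 2 1) = F 2 c ∧ dot c c = 1 := by
    have hF : g.1 (F 2 1) = F 2 ((g.1 (F 2 1)).2 2) := F2_of_apply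
      (by rw [← F4_jordanFun_of_apply_eq h0, jordanFun_E_zero_F, map_smul])
      (by rw [← F4_jordanFun_of_apply_eq h1, jordanFun_E_one_F, map_smul])
    refine ⟨_, hF, ?_⟩
    have h2 := F4_map_jordanFun g (F 2 1) (F 2 1)
    rw [hF, jordanFun_F_F, jordanFun_F_F, map_smul, map_add, h0, h1, dot_one_one] at h2
    have h3 := congrArg (fun X : J1 => X.1 0) h2
    simp [E] at h3
    simpa [F] using h3.symm
  obtain ⟨y, d, hdd, hy, hd⟩ := exists_unit_smul (c - dot 1 c • 1)
  have hd := hd (dot_one_sub c)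
  have hc' : c = dot 1 c • 1 + y • d := by rw [← hy]; abel
  have hxy : dot 1 c ^ 2 + y ^ 2 = 1 := by
    rw [hc'] at hcc
    simp only [dot_add_left, dot_add_right, dot_smul_left, dot_smul_right, dot_one_one, hdd, hd,
      dot_comm d 1] at hcc
    linarith
  obtain ⟨φ, hcos, hsin⟩ : ∃ φ : ℝ, Real.cos φ = dot 1 c ∧ Real.sin φ = y := by
    have hn : ‖(⟨dot 1 c, y⟩ : ℂ)‖ = 1 := by
      rw [Complex.norm_def, Complex.normSq_mk, ← sq, ← sq, hxy, Real.sqrt_one]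
    refine ⟨Complex.arg ⟨dot 1 c, y⟩, ?_, ?_⟩
    · rw [Complex.cos_arg (fun h => by rw [h, norm_zero] at hn; exact zero_ne_one hn), hn, div_one]
    · rw [Complex.sin_arg, hn, div_one]
  -- The rotation has angular speed 4, so time φ/4 undoes the angle φ. It fixes every E_i, so the
  -- earlier normalization survives.
  refine ⟨exp ((φ / 4) • ⁅A3, rot3 d⁆), exp_mem_expSubgroup (lie_A3_rot3_E hd 1) _,
    mem_M_of_apply ?_ ?_⟩
  · rw [F4_mul_apply, h0, exp_apply_of_apply_eq_zero (lie_A3_rot3_E hd 0)]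
  · have hF : F 2 c = Real.cos φ • F 2 1 + Real.sin φ • F 2 d := by
      rw [hcos, hsin]
      nth_rw 1 [hc']
      apply J1_ext <;> simp [F]
    rw [F4_mul_apply, hc, hF, exp_lie_A3_rot3_apply hd hdd, mul_div_cancel₀ _ four_ne_zero,
      sub_self, Real.cos_zero, Real.sin_zero]
    module

theorem expSubgroup_mul_M :
    (expSubgroup : Set F4) * (M : Set F4) = (fixedSubgroup (sigmaTilde 1) : Set F4) := by
  ext g
  constructor
  · rintro ⟨k, hk, x, hx, rfl⟩
    exact mul_mem (expSubgroup_le hk) (mem_fixedSubgroup_one_iff.2 (M_apply hx))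
  · intro hg
    obtain ⟨k₁, hk₁, h0, h1⟩ := exists_expSubgroup_apply_E_zero (mem_fixedSubgroup_one_iff.1 hg)
    obtain ⟨k₂, hk₂, hM⟩ := exists_expSubgroup_mul_mem_M h0 h1
    exact ⟨(k₂ * k₁)⁻¹, inv_mem (mul_mem hk₂ hk₁), k₂ * (k₁ * g), hM, by group⟩

end F420

end

theorem proposition9p2 (ε : F420.roots → ℤˣ)
    (hε₁ : ∀ l : F420.roots, (l : Module.Dual ℝ F420.a) = F420.alpha ∨
      (l : Module.Dual ℝ F420.a) = -F420.alpha → ε l = -1)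
    (hε₂ : ∀ l : F420.roots, (l : Module.Dual ℝ F420.a) = (2 : ℝ) • F420.alpha ∨
      (l : Module.Dual ℝ F420.a) = -((2 : ℝ) • F420.alpha) → ε l = 1) :
    F420.IsSignature ε ∧
    -- the defining conditions determine exactly one map `θ_ε`, and `thetaEps` is that map
    (∃! T : F420.f4 →ₗ[ℝ] F420.f4, F420.IsThetaEps ε T) ∧
    F420.IsThetaEps ε (F420.thetaEps ε) ∧
    -- (1) `θ_ε = dσ̃₂`
    F420.thetaEps ε = (F420.dsigma 1 : F420.f4 →ₗ[ℝ] F420.f4) ∧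
    -- (2) `θ_ε` lifts to the group as `σ̃₂`
    F420.IsDifferential (F420.sigmaTilde 1) (F420.thetaEps ε) ∧
    -- and `K_ε` is the fixed group of `σ̃₂`, the stabilizer of `E₂`, denoted `Spin⁰(8,1)`
    F420.KEps ε = (F420.fixedSubgroup (F420.sigmaTilde 1) : Set F420.F4) ∧
    F420.fixedSubgroup (F420.sigmaTilde 1) = F420.stab (F420.E 1) ∧
    F420.stab (F420.E 1) = F420.Spin81 := by
  have h1 : ∀ l : F420.roots, (l : Module.Dual ℝ F420.a) F420.A3a ^ 2 = 1 → ε l = -1 :=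
    fun _ h => F420.eps_of_sq_eq_one hε₁ h
  have h4 : ∀ l : F420.roots, (l : Module.Dual ℝ F420.a) F420.A3a ^ 2 = 4 → ε l = 1 :=
    fun _ h => F420.eps_of_sq_eq_four hε₂ h
  have hT := F420.isThetaEps_dsigma_one h1 h4
  have hex : ∃ T, F420.IsThetaEps ε T := ⟨_, hT⟩
  have hth : F420.IsThetaEps ε (F420.thetaEps ε) := by
    rw [F420.thetaEps, dif_pos hex]
    exact hex.choose_spec
  have heq : F420.thetaEps ε = (F420.dsigma 1 : F420.f4 →ₗ[ℝ] F420.f4) := hth.unique hT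
  have hK : F420.KEps0 ε = F420.expSubgroup := by
    rw [F420.KEps0, F420.kEps, heq]
    rfl
  refine ⟨F420.isSignature_of_values h1 h4, ⟨_, hT, fun T h => h.unique hT⟩, hth, heq, ?_, ?_, ?_,
    rfl⟩
  · rw [heq]
    exact F420.isDifferential_dsigma 1
  · rw [F420.KEps, hK, F420.expSubgroup_mul_M]
  · ext g
    exact F420.mem_fixedSubgroup_one_iff
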